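/- Let $H_0$ and $H$ be (possibly unbounded) self-adjoint operators on a complex Hilbert space $\mathcal H$, with spectral measures $E_0(\cdot)$ and $E(\cdot)$. Let $\mathcal H_0^{ac}$ and $\mathcal H^{ac}$ be their absolutely continuous subspaces (so $\mathcal H^{ac}$ consists of the $f$ for which the measure $(E(\cdot)f,f)$ is absolutely continuous with respect to Lebesgue measure), and let $P_0$ be the orthogonal projection onto $\mathcal H_0^{ac}$. Definitions. Let $G$ be a linear operator from $\mathcal H$ to an auxiliary Hilbert space $\mathcal G$. It is called $H$-bounded if it is defined on the domain $\mathcal D(H)$ and $G(H+i)^{-1}$ is bounded. It is called $H$-smooth if it is $H$-bounded and there is $C<\infty$ such that $$\int_{-\infty}^{\infty}\|Ge^{-iHt}f\|^2\,dt\le C^2\|f\|^2\qquad\text{for all } f\in\mathcal D(H).$$ It is called locally $H$-smooth if it is $H$-bounded and there are intervals $X_1,X_2,\dots\subset\mathbb R$, whose union is $\mathbb R$ up to a set of Lebesgue measure zero, such that every operator $GE(X_n)$ is $H$-smooth. The same definitions apply to $H_0$. Theorem. Suppose that $G_0$ and $G$ are linear operators from $\mathcal H$ to a Hilbert space $\mathcal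 G$ such that $G_0$ is locally $H_0$-smooth, $G$ is locally $H$-smooth, and $H-H_0=G^*G_0$ in the sense that $$(f_0,Hf)-(H_0f_0,f)=(G_0f_0,Gf)\qquad\text{for all } f_0\in\mathcal D(H_0),\ f\in\mathcal D(H).$$ Then both wave operators $$W_\pm(H,H_0)=\operatorname*{s-lim}_{t\to\pm\infty}e^{iHt}e^{-iH_0t}P_0$$ exist and are complete, that is, $\operatorname{ran}W_\pm(H,H_0)=\mathcal H^{ac}$. -/

import Mathlib

open MeasureTheory Filter Topology

noncomputable section

namespace Scattering

variable {𝓗 : Type*} [NormedAddCommGroup 𝓗] [InnerProductSpace ℂ 𝓗] [CompleteSpace 𝓗]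
variable {𝓖 : Type*} [NormedAddCommGroup 𝓖] [InnerProductSpace ℂ 𝓖]

/-! ### Projection-valued measures and the spectral measure of a self-adjoint operator -/

variable (𝓗) in
/-- A (normalized) projection-valued measure on the Borel sets of `ℝ`: an orthogonal projection for
every Borel set, the identity for `ℝ`, strongly countably additive. Values on sets that are not
Borel are irrelevant. -/
structure ProjectionMeasure where
  /-- the projection attached to a set -/
  toFun : Set ℝ → 𝓗 →L[ℂ] 𝓗
  isStarProjection : ∀ X, MeasurableSet X → IsStarProjection (toFun X)
  univ : toFun Set.univ = 1
  hasSum : ∀ X : ℕ → Set ℝ, (∀ n, MeasurableSet (X n)) → Pairwise (fun m n => Disjoint (X m) (X n)) →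
    ∀ f, HasSum (fun n => toFun (X n) f) (toFun (⋃ n, X n) f)

namespace ProjectionMeasure

variable (E : ProjectionMeasure 𝓗)

theorem empty (f : 𝓗) : E.toFun ∅ f = 0 := by
  have h := E.hasSum (fun _ => ∅) (fun _ => MeasurableSet.empty) (fun _ _ _ => by simp) f
  have h2 := h.summable.tendsto_atTop_zero
  exact tendsto_nhds_unique tendsto_const_nhds h2

theorem inner_self_eq {X : Set ℝ} (hX : MeasurableSet X) (f : 𝓗) :
    (inner ℂ f (E.toFun X f)).re = ‖E.toFun X f‖ ^ 2 := by
  have h := E.isStarProjection X hX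
  have h1 : E.toFun X (E.toFun X f) = E.toFun X f :=
    congrArg (fun T : 𝓗 →L[ℂ] 𝓗 => T f) h.isIdempotentElem
  have h2 : (E.toFun X).adjoint = E.toFun X := h.isSelfAdjoint
  have h3 : inner ℂ f (E.toFun X f) = inner ℂ (E.toFun X f) (E.toFun X f) := by
    conv_lhs => rw [← h1]
    rw [← ContinuousLinearMap.adjoint_inner_left, h2]
  rw [h3, inner_self_eq_norm_sq_to_K]
  norm_cast

/-- The scalar measure `X ↦ (E(X) f, f) = ‖E(X) f‖ ^ 2`. -/
def scalarMeasure (f : 𝓗) : Measure ℝ :=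
  Measure.ofMeasurable (fun X _ => ENNReal.ofReal (‖E.toFun X f‖ ^ 2))
    (by simp [E.empty])
    (by
      intro X hX hd
      have h := E.hasSum X hX hd f
      have h1 : HasSum (fun n => ‖E.toFun (X n) f‖ ^ 2) (‖E.toFun (⋃ n, X n) f‖ ^ 2) := by
        have h2 := (h.mapL (innerSL ℂ f)).mapL Complex.reCLM
        simp only [innerSL_apply_apply, Complex.reCLM_apply] at h2
        rw [E.inner_self_eq (MeasurableSet.iUnion hX)] at h2
        simpa only [E.inner_self_eq (hX _)] using h2
      rw [← h1.tsum_eq, ENNReal.ofReal_tsum_of_nonneg (fun n => by positivity) h1.summable])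

theorem scalarMeasure_apply (f : 𝓗) {X : Set ℝ} (hX : MeasurableSet X) :
    E.scalarMeasure f X = ENNReal.ofReal (‖E.toFun X f‖ ^ 2) :=
  Measure.ofMeasurable_apply X hX

theorem scalarMeasure_apply_eq_zero (f : 𝓗) {X : Set ℝ} (hX : MeasurableSet X) :
    E.scalarMeasure f X = 0 ↔ E.toFun X f = 0 := by
  rw [E.scalarMeasure_apply f hX, ENNReal.ofReal_eq_zero]
  constructor
  · intro h
    have := le_antisymm h (by positivity)
    simpa using this
  · intro h
    simp [h]

theorem absolutelyContinuous_iff (f : 𝓗) :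
    E.scalarMeasure f ≪ volume ↔
      ∀ X, MeasurableSet X → volume X = 0 → E.toFun X f = 0 := by
  constructor
  · intro h X hX h0
    exact (E.scalarMeasure_apply_eq_zero f hX).1 (h h0)
  · intro h
    exact Measure.AbsolutelyContinuous.mk fun X hX h0 =>
      (E.scalarMeasure_apply_eq_zero f hX).2 (h X hX h0)

/-- The absolutely continuous subspace: the vectors `f` for which the measure `(E(·) f, f)` is
absolutely continuous with respect to Lebesgue measure. -/
def acSubspace : Submodule ℂ 𝓗 where
  carrier := {f | E.scalarMeasure f ≪ volume}
  zero_mem' := by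
    simp only [Set.mem_ofPred_eq, absolutelyContinuous_iff]
    intro X _ _
    simp
  add_mem' := by
    intro f g hf hg
    simp only [Set.mem_ofPred_eq, absolutelyContinuous_iff] at hf hg ⊢
    intro X hX h0
    simp [hf X hX h0, hg X hX h0]
  smul_mem' := by
    intro c f hf
    simp only [Set.mem_ofPred_eq, absolutelyContinuous_iff] at hf ⊢
    intro X hX h0
    simp [hf X hX h0]

theorem mem_acSubspace (f : 𝓗) : f ∈ E.acSubspace ↔ E.scalarMeasure f ≪ volume := Iff.rfl

theorem isClosed_acSubspace : IsClosed (E.acSubspace : Set 𝓗) := by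
  have : (E.acSubspace : Set 𝓗) =
      ⋂ (X : Set ℝ) (_ : MeasurableSet X) (_ : volume X = 0), {f | E.toFun X f = 0} := by
    ext f
    simp only [SetLike.mem_coe, mem_acSubspace, absolutelyContinuous_iff, Set.mem_iInter,
      Set.mem_ofPred_eq]
  rw [this]
  exact isClosed_iInter fun X => isClosed_iInter fun _ => isClosed_iInter fun _ =>
    isClosed_eq (E.toFun X).continuous continuous_const

instance : CompleteSpace E.acSubspace := E.isClosed_acSubspace.completeSpace_coe

/-- `H = ∫ λ dE(λ)`: the domain of `H` consists of the `f` with `∫ λ² d(E(λ) f, f) < ∞`, and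
`(H f, f) = ∫ λ d(E(λ) f, f)` there. By polarization this determines `H`. -/
def IsSpectralMeasureOf (H : 𝓗 →ₗ.[ℂ] 𝓗) : Prop :=
  (∀ f : 𝓗, f ∈ H.domain ↔ ∫⁻ l, ‖l‖ₑ ^ 2 ∂(E.scalarMeasure f) < ⊤) ∧
  ∀ f : H.domain, inner ℂ (f : 𝓗) (H f) = ((∫ l, l ∂(E.scalarMeasure (f : 𝓗)) : ℝ) : ℂ)

open Classical in
/-- The unit mass at the point `0`. -/
instance : Inhabited (ProjectionMeasure 𝓗) where
  default :=
    { toFun := fun X => if (0 : ℝ) ∈ X then 1 else 0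
      isStarProjection := by
        intro X _
        split_ifs
        · exact IsStarProjection.one _
        · exact IsStarProjection.zero _
      univ := by simp
      hasSum := by
        intro X _ hd f
        by_cases h : ∃ n, (0 : ℝ) ∈ X n
        · obtain ⟨n, hn⟩ := h
          have h0 : (0 : ℝ) ∈ ⋃ n, X n := Set.mem_iUnion.2 ⟨n, hn⟩
          rw [if_pos h0]
          convert hasSum_single (f := fun m => (if (0 : ℝ) ∈ X m then (1 : 𝓗 →L[ℂ] 𝓗) else 0) f)
            n ?_ using 1
          · simp [hn]
          · intro m hm
            have : (0 : ℝ) ∉ X m := fun h => Set.disjoint_left.1 (hd hm) h hn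
            simp [this]
        · push Not at h
          have h0 : (0 : ℝ) ∉ ⋃ n, X n := by simpa using h
          simp only [h, h0, if_false]
          simp }

end ProjectionMeasure

open Classical in
/-- The spectral measure `E` of the self-adjoint operator `H`; for self-adjoint `H` it exists and is
unique by the spectral theorem. -/
def spectralMeasure (H : 𝓗 →ₗ.[ℂ] 𝓗) : ProjectionMeasure 𝓗 :=
  if h : ∃ E : ProjectionMeasure 𝓗, E.IsSpectralMeasureOf H then h.choose else default

/-- The absolutely continuous subspace of `H`. -/
def acSubspace (H : 𝓗 →ₗ.[ℂ] 𝓗) : Submodule ℂ 𝓗 := (spectralMeasure H).acSubspace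

instance (H : 𝓗 →ₗ.[ℂ] 𝓗) : CompleteSpace (acSubspace H) :=
  inferInstanceAs (CompleteSpace (spectralMeasure H).acSubspace)

/-! ### The unitary group -/

/-- `U` is the strongly continuous unitary group `U(t) = e^{-iHt}`, that is, the one whose
infinitesimal generator is `-iH` (with its exact domain). -/
structure IsUnitaryGroupOf (H : 𝓗 →ₗ.[ℂ] 𝓗) (U : ℝ → 𝓗 →L[ℂ] 𝓗) : Prop where
  unitary : ∀ t, U t ∈ unitary (𝓗 →L[ℂ] 𝓗)
  add : ∀ s t, U (s + t) = U s * U t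
  continuous : ∀ f, Continuous fun t => U t f
  generator : ∀ f g : 𝓗, HasDerivAt (fun t => U t f) (-Complex.I • g) 0 ↔ (f, g) ∈ H.graph

open Classical in
/-- `evolution H t` is `e^{-iHt}`; for self-adjoint `H` this group exists and is unique by Stone's
theorem. -/
def evolution (H : 𝓗 →ₗ.[ℂ] 𝓗) : ℝ → 𝓗 →L[ℂ] 𝓗 :=
  if h : ∃ U, IsUnitaryGroupOf H U then h.choose else 1

/-! ### Smoothness -/

/-- `G` is `H`-bounded: `G` is defined on the domain of `H` and `G (H + i)⁻¹` is bounded, i.e.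
`‖G f‖ ≤ C ‖(H + i) f‖` for all `f` in the domain of `H`. -/
def IsRelBounded (G : 𝓗 →ₗ.[ℂ] 𝓖) (H : 𝓗 →ₗ.[ℂ] 𝓗) : Prop :=
  ∃ hdom : H.domain ≤ G.domain, ∃ C : ℝ, ∀ f : H.domain,
    ‖G ⟨f, hdom f.2⟩‖ ≤ C * ‖H f + Complex.I • (f : 𝓗)‖

open Classical in
/-- `‖G f‖`, understood as `+∞` if `f` is not in the domain of `G`. -/
def pmapNorm (G : 𝓗 →ₗ.[ℂ] 𝓖) (f : 𝓗) : ENNReal :=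
  if h : f ∈ G.domain then ‖G ⟨f, h⟩‖ₑ else ⊤

/-- `G` is `H`-smooth: `G` is `H`-bounded and `∫ ‖G e^{-iHt} f‖² dt ≤ C² ‖f‖²`. The bound is required
for `f` in the (dense, invariant) domain of `H`, on which `G e^{-iHt} f` is defined for every `t`;
by continuity it then holds for all `f`, with `G` replaced by its closure. -/
def IsSmooth (G : 𝓗 →ₗ.[ℂ] 𝓖) (H : 𝓗 →ₗ.[ℂ] 𝓗) : Prop :=
  IsRelBounded G H ∧ ∃ C : ℝ, ∀ f ∈ H.domain,
    ∫⁻ t : ℝ, pmapNorm G (evolution H t f) ^ 2 ≤ ENNReal.ofReal (C ^ 2 * ‖f‖ ^ 2)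

/-- The composition `G B` of an unbounded operator with a bounded one, on its natural domain
`{f | B f ∈ dom G}`. -/
def compBounded (G : 𝓗 →ₗ.[ℂ] 𝓖) (B : 𝓗 →L[ℂ] 𝓗) : 𝓗 →ₗ.[ℂ] 𝓖 where
  domain := G.domain.comap B.toLinearMap
  toFun := G.toFun.comp (B.toLinearMap.restrict fun _ h => h)

/-- `G` is locally `H`-smooth: `G` is `H`-bounded and there are countably many intervals `X n`, whose
union is `ℝ` up to a Lebesgue null set, such that every `G E(X n)` is `H`-smooth. -/
def IsLocallySmooth (G : 𝓗 →ₗ.[ℂ] 𝓖) (H : 𝓗 →ₗ.[ℂ] 𝓗) : Prop :=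
  IsRelBounded G H ∧ ∃ X : ℕ → Set ℝ, (∀ n, (X n).OrdConnected) ∧ volume (⋃ n, X n)ᶜ = 0 ∧
    ∀ n, IsSmooth (compBounded G ((spectralMeasure H).toFun (X n))) H

/-- `H - H₀ = G* G₀` in the sense of forms:
`(f₀, H f) - (H₀ f₀, f) = (G₀ f₀, G f)` for `f₀` in the domain of `H₀` and `f` in that of `H`
(here `G₀` is defined on the domain of `H₀` and `G` on that of `H`). -/
def DifferenceFactors (H H₀ : 𝓗 →ₗ.[ℂ] 𝓗) (G G₀ : 𝓗 →ₗ.[ℂ] 𝓖) : Prop :=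
  ∃ (h : H.domain ≤ G.domain) (h₀ : H₀.domain ≤ G₀.domain), ∀ (f : H.domain) (f₀ : H₀.domain),
    inner ℂ (H f) (f₀ : 𝓗) - inner ℂ (f : 𝓗) (H₀ f₀) = inner ℂ (G ⟨f, h f.2⟩) (G₀ ⟨f₀, h₀ f₀.2⟩)

/-! ### Wave operators -/

/-- `W` is the strong limit of `e^{iHt} e^{-iH₀t} P₀` along the filter `l`, where `P₀` is the
orthogonal projection onto the absolutely continuous subspace of `H₀`. It is the wave operator
`W₊(H, H₀)` for `l = atTop` and `W₋(H, H₀)` for `l = atBot`. -/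
def IsWaveOperator (H H₀ : 𝓗 →ₗ.[ℂ] 𝓗) (l : Filter ℝ) (W : 𝓗 →L[ℂ] 𝓗) : Prop :=
  ∀ f : 𝓗, Tendsto (fun t => evolution H (-t) (evolution H₀ t ((acSubspace H₀).starProjection f)))
    l (𝓝 (W f))

/-- The wave operator along `l` exists and is complete, i.e. its range is the absolutely continuous
subspace of `H`. -/
def WaveOperatorExistsComplete (H H₀ : 𝓗 →ₗ.[ℂ] 𝓗) (l : Filter ℝ) : Prop :=
  ∃ W : 𝓗 →L[ℂ] 𝓗, IsWaveOperator H H₀ l W ∧ Set.range W = (acSubspace H : Set 𝓗)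

end Scattering

end

/-!
Existence and completeness of the wave operators is reduced to one statement that is symmetric in
the pairs `(H, G)` and `(H₀, G₀)`: for `f` in the absolutely continuous subspace of `H₀`, the vectors
`e^{iHt} e^{-iH₀t} f` converge as `t → ±∞` (`FormBound.acSubspace_le`). Existence is immediate. For
completeness, exchange the two operators: `f = lim e^{iH₀t} e^{-iHt} g` exists for `g` in the
absolutely continuous subspace of `H`, and unitarity gives `g = lim e^{iHt} e^{-iH₀t} f`. A limit has
the same spectral measure as the vector it comes from, because the intertwining property makes the
Fourier transforms of the two measures equal (`scalarMeasure_eq_of_tendsto`); so limits stay in the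
absolutely continuous subspaces.

For the convergence, almost all of the line is covered by small sets `K`, within `δ` of a point `a`,
such that `K` lies in an interval `X` with `G₀ E₀(X)` smooth, and `[a - 2δ, a + 2δ]` in an interval
`Y` with `G E(Y)` smooth (`exists_refinement`). By density it suffices to take `f` in the range of
`E₀(K)`, and there the vector is split by `E(Y)` and `E(Yᶜ)`.

* The part in `E(Y)` converges by Cook's method: the derivative of `(e^{-iHt} E(Y) v, e^{-iH₀t} f)`
  is, up to a factor `i`, the product `(G e^{-iHt} E(Y) v, G₀ e^{-iH₀t} f)` of two square integrable
  trajectories (`FormBound.exists_tendsto_toFun`).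
* The part in `E(Yᶜ)` vanishes asymptotically (`FormBound.tendsto_toFun_zero`). The trajectory
  `G₀ e^{-iH₀t} f` is square integrable and uniformly continuous, hence tends to zero, so by the
  resolvent identity `(H - z)⁻¹` and `(H₀ - z)⁻¹` may be exchanged on `e^{-iH₀t} f` in the limit. Take
  `z = a + i` and write `f = (H₀ - z)⁻¹ g`. On the range of `E(Yᶜ)` the resolvent of `H` is bounded by
  `((2δ)² + 1)^{-1/2}`, while `‖g‖ ≤ (δ² + 1)^{1/2} ‖f‖`. The limit superior of
  `‖E(Yᶜ) e^{-iH₀t} f‖` is therefore at most `q ‖f‖` with a fixed `q < 1`, and by iteration at most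
  `qⁿ ‖f‖` for all `n`.

The spectral theorem for unbounded self-adjoint operators and Stone's theorem are needed to give
meaning to the spectral measures and to the groups, and they are proved here. A `BorelCalculus`
is a functional calculus on an `L²`-dense `*`-algebra of bounded functions; it extends to isometries
of `L²(μ x)` into the Hilbert space. The calculus is used twice. For continuous functions on the
spectrum of the Cayley transform it produces the spectral measure
(`exists_isSpectralMeasureOf`). For simple functions of an arbitrary spectral measure `E` of `H` it
gives `H = ∫ λ dE(λ)` and the group `∫ e^{-itλ} dE(λ)`, which is the only one with generator `-iH`
(`ProjectionMeasure.isUnitaryGroupOf_group`, `IsUnitaryGroupOf.apply_eq_of_generator`).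
-/

noncomputable section

namespace Scattering

variable {𝓗 : Type*} [NormedAddCommGroup 𝓗] [InnerProductSpace ℂ 𝓗] [CompleteSpace 𝓗]
variable {𝓖 : Type*} [NormedAddCommGroup 𝓖] [InnerProductSpace ℂ 𝓖]

/-! ### Self-adjoint operators and their resolvents -/

section SelfAdjoint

variable {H : 𝓗 →ₗ.[ℂ] 𝓗}

theorem inner_apply_left (hH : IsSelfAdjoint H) (f g : H.domain) :
    inner ℂ (H f) (g : 𝓗) = inner ℂ (f : 𝓗) (H g) := by
  have h := LinearPMap.adjoint_isFormalAdjoint hH.dense_domain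
  rw [LinearPMap.isSelfAdjoint_def.1 hH] at h
  exact h f g

/-- A self-adjoint operator is maximal: it contains every pair that is formally adjoint to it. -/
theorem mem_graph_of_inner_eq (hH : IsSelfAdjoint H) {f g : 𝓗}
    (h : ∀ v : H.domain, inner ℂ (H v) f = inner ℂ (v : 𝓗) g) : (f, g) ∈ H.graph := by
  have h1 := LinearPMap.adjoint_graph_eq_graph_adjoint hH.dense_domain
  rw [LinearPMap.isSelfAdjoint_def.1 hH] at h1
  rw [h1, Submodule.mem_adjoint_iff]
  intro a b hab
  obtain ⟨v, rfl, rfl⟩ := (LinearPMap.mem_graph_iff H).1 hab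
  exact sub_eq_zero.2 (h v)

/-- The cross term vanishes because `(H f + a f, f)` is real. -/
theorem norm_apply_add_smul_sq (hH : IsSelfAdjoint H) (a b : ℝ) (f : H.domain) :
    ‖H f + (a + b * Complex.I : ℂ) • (f : 𝓗)‖ ^ 2 =
      ‖H f + (a : ℂ) • (f : 𝓗)‖ ^ 2 + b ^ 2 * ‖(f : 𝓗)‖ ^ 2 := by
  have hs : (inner ℂ (H f + (a : ℂ) • (f : 𝓗)) (f : 𝓗)).im = 0 := by
    have h1 := inner_apply_left hH f f
    have h2 : (inner ℂ (H f) (f : 𝓗)).im = 0 := by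
      have h3 := congrArg Complex.im (inner_conj_symm (𝕜 := ℂ) (f : 𝓗) (H f))
      rw [← h1] at h3
      simp only [Complex.conj_im] at h3
      have := h3
      linarith
    rw [inner_add_left, inner_smul_left, Complex.add_im, h2, inner_self_eq_norm_sq_to_K]
    simp [← Complex.ofReal_pow, ← Complex.ofReal_mul]
  have hc : H f + (a + b * Complex.I : ℂ) • (f : 𝓗) =
      (H f + (a : ℂ) • (f : 𝓗)) + (b * Complex.I : ℂ) • (f : 𝓗) := by
    rw [add_smul, add_assoc]
  rw [hc, @norm_add_sq ℂ, inner_smul_right, norm_smul]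
  have : RCLike.re ((b * Complex.I : ℂ) * inner ℂ (H f + (a : ℂ) • (f : 𝓗)) (f : 𝓗)) = 0 := by
    simp only [RCLike.re_to_complex, Complex.mul_re, Complex.mul_im, hs]
    simp
  rw [this]
  simp [mul_pow]

theorem norm_apply_add_I_smul (hH : IsSelfAdjoint H) (f : H.domain) :
    ‖H f + Complex.I • (f : 𝓗)‖ = ‖H f - Complex.I • (f : 𝓗)‖ := by
  have h1 := norm_apply_add_smul_sq hH 0 1 f
  have h2 := norm_apply_add_smul_sq hH 0 (-1) f
  simp only [Complex.ofReal_zero, Complex.ofReal_one, Complex.ofReal_neg, zero_add, one_mul,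
    neg_mul, neg_smul] at h1 h2
  rw [sub_eq_add_neg]
  have h3 := h1.trans (by simpa using h2.symm)
  exact (sq_eq_sq₀ (norm_nonneg _) (norm_nonneg _)).1 h3

/-- The fundamental criterion of self-adjointness: `H + z` is onto for every nonreal `z`. -/
theorem exists_apply_add_smul_eq (hH : IsSelfAdjoint H) (a : ℝ) {b : ℝ} (hb : b ≠ 0) (y : 𝓗) :
    ∃ f : H.domain, H f + (a + b * Complex.I : ℂ) • (f : 𝓗) = y := by
  set c : ℂ := a + b * Complex.I with hc
  let T : H.domain →ₗ[ℂ] 𝓗 := H.toFun + c • H.domain.subtype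
  have hT : ∀ f, T f = H f + c • (f : 𝓗) := fun f => rfl
  have hlow : ∀ f : H.domain, |b| * ‖(f : 𝓗)‖ ≤ ‖T f‖ := by
    intro f
    have h1 := norm_apply_add_smul_sq hH a b f
    refine abs_le_of_sq_le_sq' ?_ (norm_nonneg _) |>.2
    rw [hT, h1, mul_pow, sq_abs]
    nlinarith [sq_nonneg ‖H f + (a : ℂ) • (f : 𝓗)‖]
  have hb' : 0 < |b| := abs_pos.2 hb
  -- the lower bound on `T = H + z` makes its range closed
  have hclosed : IsClosed (LinearMap.range T : Set 𝓗) := by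
    refine isClosed_of_closure_subset fun y hy => ?_
    obtain ⟨u, hu, hlim⟩ := mem_closure_iff_seq_limit.1 hy
    choose f hf using hu
    have hcau : CauchySeq (fun n => ((f n : H.domain) : 𝓗)) := by
      have h1 := hlim.cauchySeq
      rw [Metric.cauchySeq_iff] at h1 ⊢
      intro ε hε
      obtain ⟨N, hN⟩ := h1 (|b| * ε) (by positivity)
      refine ⟨N, fun m hm n hn => ?_⟩
      have h2 := hN m hm n hn
      rw [dist_eq_norm, ← hf, ← hf, ← map_sub] at h2
      have h3 := hlow (f m - f n)
      rw [dist_eq_norm]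
      have h4 : |b| * ‖(f m : 𝓗) - (f n : 𝓗)‖ < |b| * ε := lt_of_le_of_lt (by simpa using h3) h2
      exact lt_of_mul_lt_mul_left h4 hb'.le
    obtain ⟨f₀, hf₀⟩ := cauchySeq_tendsto_of_complete hcau
    have hHf : Tendsto (fun n => H (f n)) atTop (𝓝 (y - c • f₀)) := by
      have : (fun n => H (f n)) = fun n => u n - c • (f n : 𝓗) := by
        funext n
        rw [← hf, hT]; abel
      rw [this]
      exact hlim.sub (hf₀.const_smul c)
    have hmem : (f₀, y - c • f₀) ∈ H.graph := by
      refine mem_graph_of_inner_eq hH fun v => ?_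
      have h1 : Tendsto (fun n => inner ℂ (H v) (f n : 𝓗)) atTop (𝓝 (inner ℂ (H v) f₀)) :=
        tendsto_const_nhds.inner hf₀
      have h2 : Tendsto (fun n => inner ℂ (v : 𝓗) (H (f n))) atTop
          (𝓝 (inner ℂ (v : 𝓗) (y - c • f₀))) := tendsto_const_nhds.inner hHf
      refine tendsto_nhds_unique h1 (h2.congr fun n => ?_)
      exact (inner_apply_left hH v (f n)).symm
    obtain ⟨w, hw1, hw2⟩ := (LinearPMap.mem_graph_iff H).1 hmem
    simp only at hw1 hw2
    refine ⟨w, ?_⟩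
    rw [hT, hw2, hw1]; abel
  -- a vector orthogonal to the range lies in the domain and is an eigenvector for `-z̄`, so it is `0`
  have hdense : (LinearMap.range T)ᗮ = ⊥ := by
    rw [Submodule.eq_bot_iff]
    intro g hg
    rw [Submodule.mem_orthogonal] at hg
    have hmem : (g, -((starRingEnd ℂ) c • g)) ∈ H.graph := by
      refine mem_graph_of_inner_eq hH fun v => ?_
      have h1 := hg (T v) ⟨v, rfl⟩
      rw [hT, inner_add_left, inner_smul_left] at h1
      rw [inner_neg_right, inner_smul_right]
      exact eq_neg_of_add_eq_zero_left h1
    obtain ⟨w, hw1, hw2⟩ := (LinearPMap.mem_graph_iff H).1 hmem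
    simp only at hw1 hw2
    have h1 := norm_apply_add_smul_sq hH a (-b) w
    have h2 : (a + (-b : ℝ) * Complex.I : ℂ) = (starRingEnd ℂ) c := by simp [hc]
    rw [h2, hw2, hw1] at h1
    simp only [neg_add_cancel, norm_zero] at h1
    have h3 : b ^ 2 * ‖g‖ ^ 2 ≤ 0 := by
      nlinarith [sq_nonneg ‖-((starRingEnd ℂ) c • g) + (a : ℂ) • g‖]
    have h4 : ‖g‖ ^ 2 = 0 := by
      have : 0 < b ^ 2 := by positivity
      nlinarith [sq_nonneg ‖g‖]
    simpa using h4
  have htop : LinearMap.range T = ⊤ := by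
    have h1 := (Submodule.topologicalClosure_eq_top_iff (K := LinearMap.range T)).2 hdense
    rwa [IsClosed.submodule_topologicalClosure_eq hclosed] at h1
  have : y ∈ LinearMap.range T := htop ▸ Submodule.mem_top
  obtain ⟨f, hf⟩ := this
  exact ⟨f, hf⟩

end SelfAdjoint

/-! ### Extending a functional calculus from a dense algebra to Borel functions -/

variable {S : Type*} [MeasurableSpace S]

variable (𝓗 S) in
/-- A functional calculus on a `*`-algebra of bounded measurable functions on `S`. The algebra and
the calculus are encoded together as the space `alg` of pairs `(a, a(T))`. The diagonal matrix
elements of `a(T)` are integrals against finite measures `μ x`, and the algebra is dense in `L²(ν)`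
for every finite measure `ν`. -/
structure BorelCalculus where
  /-- the pairs consisting of a function and the operator attached to it -/
  alg : Submodule ℂ ((S → ℂ) × (𝓗 →L[ℂ] 𝓗))
  /-- the measure which represents the diagonal matrix elements at a vector -/
  μ : 𝓗 → Measure S
  finite : ∀ x, IsFiniteMeasure (μ x)
  mul_mem : ∀ p ∈ alg, ∀ q ∈ alg, p * q ∈ alg
  star_mem : ∀ p ∈ alg, star p ∈ alg
  measurable : ∀ p ∈ alg, Measurable p.1
  bounded : ∀ p ∈ alg, ∃ C : ℝ, ∀ s, ‖p.1 s‖ ≤ C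
  inner_eq : ∀ p ∈ alg, ∀ x, inner ℂ x (p.2 x) = ∫ s, p.1 s ∂(μ x)
  dense : ∀ (ν : Measure S) [IsFiniteMeasure ν] (g : S → ℂ), MemLp g 2 ν → ∀ ε : ENNReal, ε ≠ 0 →
    ∃ p ∈ alg, eLpNorm (p.1 - g) 2 ν ≤ ε

/-- Bounded measurable functions. -/
def IsBddMeas (g : S → ℂ) : Prop := Measurable g ∧ ∃ C : ℝ, ∀ s, ‖g s‖ ≤ C

theorem IsBddMeas.memLp {g : S → ℂ} (hg : IsBddMeas g) (ν : Measure S) [IsFiniteMeasure ν] :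
    MemLp g 2 ν := by
  obtain ⟨hm, C, hC⟩ := hg
  exact MemLp.of_bound hm.aestronglyMeasurable C (Eventually.of_forall hC)

theorem IsBddMeas.mul_memLp {g u : S → ℂ} (hg : IsBddMeas g) {ν : Measure S}
    (hu : MemLp u 2 ν) : MemLp (g * u) 2 ν := by
  obtain ⟨hm, C, hC⟩ := hg
  refine (hu.const_mul (C : ℂ)).mono (hm.aestronglyMeasurable.mul hu.1) (Eventually.of_forall ?_)
  intro s
  simp only [Pi.mul_apply, norm_mul, Complex.norm_real]
  gcongr
  exact (hC s).trans (le_abs_self C)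

theorem IsBddMeas.mul {g h : S → ℂ} (hg : IsBddMeas g) (hh : IsBddMeas h) : IsBddMeas (g * h) := by
  obtain ⟨hm, C, hC⟩ := hg
  obtain ⟨hm', D, hD⟩ := hh
  refine ⟨hm.mul hm', C * D, fun s => ?_⟩
  rw [Pi.mul_apply, norm_mul]
  exact mul_le_mul (hC s) (hD s) (norm_nonneg _) ((norm_nonneg _).trans (hC s))

theorem IsBddMeas.indicator_one {X : Set S} (hX : MeasurableSet X) :
    IsBddMeas (X.indicator (1 : S → ℂ)) :=
  ⟨measurable_one.indicator hX, 1, fun s => by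
    by_cases h : s ∈ X <;> simp [h]⟩

/-- A map that preserves the norms computed in a space `L` extends to an isometry of `L`. -/
theorem exists_linearIsometry_extension {V L : Type*} [AddCommGroup V] [Module ℂ V]
    [NormedAddCommGroup L] [NormedSpace ℂ L] (A : V →ₗ[ℂ] L) (B : V →ₗ[ℂ] 𝓗)
    (hA : DenseRange A) (h : ∀ v, ‖B v‖ = ‖A v‖) :
    ∃ J : L →ₗᵢ[ℂ] 𝓗, ∀ v, J (A v) = B v := by
  have hb : ∃ C, ∀ v, ‖B v‖ ≤ C * ‖A v‖ := ⟨1, fun v => by rw [h, one_mul]⟩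
  have he : ∀ v, B.extendOfNorm A (A v) = B v := LinearMap.extendOfNorm_eq hA hb
  refine ⟨⟨(B.extendOfNorm A).toLinearMap, ?_⟩, he⟩
  intro u
  refine hA.induction (P := fun u => ‖B.extendOfNorm A u‖ = ‖u‖) ?_ ?_ u
  · rintro _ ⟨v, rfl⟩
    rw [he, h]
  · exact isClosed_eq (by fun_prop) continuous_norm

namespace BorelCalculus

variable (Φ : BorelCalculus 𝓗 S)

instance (x : 𝓗) : IsFiniteMeasure (Φ.μ x) := Φ.finite x

theorem isBddMeas (p : Φ.alg) : IsBddMeas p.1.1 := ⟨Φ.measurable _ p.2, Φ.bounded _ p.2⟩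

theorem norm_apply_sq (p : Φ.alg) (x : 𝓗) :
    ‖p.1.2 x‖ₑ ^ 2 = ∫⁻ s, ‖p.1.1 s‖ₑ ^ 2 ∂(Φ.μ x) := by
  have h1 := Φ.inner_eq _ (Φ.mul_mem _ (Φ.star_mem _ p.2) _ p.2) x
  have h2 : inner ℂ x ((star p.1 * p.1).2 x) = ((‖p.1.2 x‖ ^ 2 : ℝ) : ℂ) := by
    change inner ℂ x ((ContinuousLinearMap.adjoint p.1.2) (p.1.2 x)) = _
    rw [ContinuousLinearMap.adjoint_inner_right, inner_self_eq_norm_sq_to_K]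
    norm_cast
  have h3 : ∀ s, (star p.1 * p.1).1 s = ((‖p.1.1 s‖ ^ 2 : ℝ) : ℂ) := by
    intro s
    change star (p.1.1 s) * p.1.1 s = _
    rw [Complex.star_def, Complex.conj_mul']
    norm_cast
  rw [h2] at h1
  simp only [h3] at h1
  rw [integral_complex_ofReal, Complex.ofReal_inj] at h1
  have h4 : Integrable (fun s => ‖p.1.1 s‖ ^ 2) (Φ.μ x) :=
    ((Φ.isBddMeas p).memLp (Φ.μ x)).integrable_norm_pow (by norm_num)
  have h5 := ofReal_integral_eq_lintegral_ofReal h4 (Eventually.of_forall fun s => by positivity)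
  rw [← h1, ENNReal.ofReal_pow (norm_nonneg _), ofReal_norm] at h5
  rw [h5]
  refine lintegral_congr fun s => ?_
  rw [ENNReal.ofReal_pow (norm_nonneg _), ofReal_norm]

theorem eLpNorm_two_sq {ν : Measure S} (g : S → ℂ) :
    eLpNorm g 2 ν ^ 2 = ∫⁻ s, ‖g s‖ₑ ^ 2 ∂ν := by
  have := eLpNorm_nnreal_pow_eq_lintegral (μ := ν) (f := g) (p := 2) (by norm_num)
  simpa using this

theorem exists_isometry (x : 𝓗) : ∃ J : Lp ℂ 2 (Φ.μ x) →ₗᵢ[ℂ] 𝓗,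
    ∀ p : Φ.alg, J (((Φ.isBddMeas p).memLp (Φ.μ x)).toLp p.1.1) = p.1.2 x := by
  let A : Φ.alg →ₗ[ℂ] Lp ℂ 2 (Φ.μ x) :=
    { toFun := fun p => ((Φ.isBddMeas p).memLp (Φ.μ x)).toLp p.1.1
      map_add' := fun p q => MemLp.toLp_add _ _
      map_smul' := fun c p => MemLp.toLp_const_smul c _ }
  let B : Φ.alg →ₗ[ℂ] 𝓗 :=
    { toFun := fun p => p.1.2 x
      map_add' := fun p q => rfl
      map_smul' := fun c p => rfl }
  have hA : DenseRange A := by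
    intro u
    rw [EMetric.mem_closure_iff]
    intro ε hε
    obtain ⟨δ, hδ, hδε⟩ := exists_between hε
    obtain ⟨p, hp, hpu⟩ := Φ.dense (Φ.μ x) u (Lp.memLp u) δ hδ.ne'
    refine ⟨A ⟨p, hp⟩, ⟨⟨p, hp⟩, rfl⟩, ?_⟩
    refine lt_of_le_of_lt ?_ hδε
    rw [edist_comm]
    refine le_trans (le_of_eq ?_) hpu
    have h1 : u = (Lp.memLp u).toLp u := (Lp.toLp_coeFn u _).symm
    conv_lhs => rw [h1]
    exact Lp.edist_toLp_toLp _ _ ((Φ.isBddMeas ⟨p, hp⟩).memLp _) _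
  have hn : ∀ p, ‖B p‖ = ‖A p‖ := by
    intro p
    have h1 : ‖B p‖ₑ ^ 2 = ‖A p‖ₑ ^ 2 := by
      have h2 : A p = ((Φ.isBddMeas p).memLp (Φ.μ x)).toLp p.1.1 := rfl
      rw [h2, Lp.enorm_toLp, eLpNorm_two_sq]
      exact Φ.norm_apply_sq p x
    have h2 : ‖B p‖ₑ = ‖A p‖ₑ := (ENNReal.pow_right_strictMono (n := 2) (by norm_num)).injective h1
    simpa [enorm_eq_iff_norm_eq] using h2
  exact exists_linearIsometry_extension A B hA hn

open Classical in
/-- The vector `g(T) x`, for `g` square integrable with respect to `μ x` (and zero for other `g`). -/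
def I (x : 𝓗) (g : S → ℂ) : 𝓗 :=
  if h : MemLp g 2 (Φ.μ x) then (Φ.exists_isometry x).choose (h.toLp g) else 0

variable {Φ}

theorem I_of_memLp {x : 𝓗} {g : S → ℂ} (h : MemLp g 2 (Φ.μ x)) :
    Φ.I x g = (Φ.exists_isometry x).choose (h.toLp g) := dif_pos h

theorem I_alg (p : Φ.alg) (x : 𝓗) : Φ.I x p.1.1 = p.1.2 x := by
  rw [I_of_memLp ((Φ.isBddMeas p).memLp _)]
  exact (Φ.exists_isometry x).choose_spec p

theorem I_add {x : 𝓗} {g h : S → ℂ} (hg : MemLp g 2 (Φ.μ x)) (hh : MemLp h 2 (Φ.μ x)) :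
    Φ.I x (g + h) = Φ.I x g + Φ.I x h := by
  rw [I_of_memLp hg, I_of_memLp hh, I_of_memLp (hg.add hh), MemLp.toLp_add, map_add]

theorem I_sub {x : 𝓗} {g h : S → ℂ} (hg : MemLp g 2 (Φ.μ x)) (hh : MemLp h 2 (Φ.μ x)) :
    Φ.I x (g - h) = Φ.I x g - Φ.I x h := by
  rw [I_of_memLp hg, I_of_memLp hh, I_of_memLp (hg.sub hh), MemLp.toLp_sub, map_sub]

theorem I_smul {x : 𝓗} {g : S → ℂ} (hg : MemLp g 2 (Φ.μ x)) (c : ℂ) :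
    Φ.I x (c • g) = c • Φ.I x g := by
  rw [I_of_memLp hg, I_of_memLp (hg.const_smul c), MemLp.toLp_const_smul, map_smul]

theorem I_congr {x : 𝓗} {g h : S → ℂ} (hg : MemLp g 2 (Φ.μ x)) (hgh : g =ᵐ[Φ.μ x] h) :
    Φ.I x g = Φ.I x h := by
  rw [I_of_memLp hg, I_of_memLp (hg.ae_eq hgh), MemLp.toLp_congr hg (hg.ae_eq hgh) hgh]

theorem enorm_I {x : 𝓗} {g : S → ℂ} (hg : MemLp g 2 (Φ.μ x)) :
    ‖Φ.I x g‖ₑ = eLpNorm g 2 (Φ.μ x) := by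
  rw [I_of_memLp hg, LinearIsometry.enorm_map, Lp.enorm_toLp]

theorem enorm_I_sq {x : 𝓗} {g : S → ℂ} (hg : MemLp g 2 (Φ.μ x)) :
    ‖Φ.I x g‖ₑ ^ 2 = ∫⁻ s, ‖g s‖ₑ ^ 2 ∂(Φ.μ x) := by
  rw [enorm_I hg, eLpNorm_two_sq]

theorem inner_I {x : 𝓗} {g h : S → ℂ} (hg : MemLp g 2 (Φ.μ x)) (hh : MemLp h 2 (Φ.μ x)) :
    inner ℂ (Φ.I x g) (Φ.I x h) = ∫ s, h s * (starRingEnd ℂ) (g s) ∂(Φ.μ x) := by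
  rw [I_of_memLp hg, I_of_memLp hh, LinearIsometry.inner_map_map, L2.inner_def]
  refine integral_congr_ae ?_
  filter_upwards [hg.coeFn_toLp, hh.coeFn_toLp] with s h1 h2
  rw [h1, h2]
  rfl

theorem tendsto_I {ι : Type*} {l : Filter ι} {x : 𝓗} {u : ι → S → ℂ} {g : S → ℂ}
    (hu : ∀ i, MemLp (u i) 2 (Φ.μ x)) (hg : MemLp g 2 (Φ.μ x))
    (h : Tendsto (fun i => eLpNorm (u i - g) 2 (Φ.μ x)) l (𝓝 0)) :
    Tendsto (fun i => Φ.I x (u i)) l (𝓝 (Φ.I x g)) := by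
  rw [tendsto_iff_edist_tendsto_0]
  refine h.congr fun i => ?_
  rw [edist_eq_enorm_sub, ← I_sub (hu i) hg, enorm_I ((hu i).sub hg)]

variable (Φ) in
theorem exists_seq (ν : Measure S) [IsFiniteMeasure ν] {g : S → ℂ} (hg : MemLp g 2 ν) :
    ∃ p : ℕ → Φ.alg, Tendsto (fun n => eLpNorm ((p n).1.1 - g) 2 ν) atTop (𝓝 0) := by
  choose p hp hpg using fun n : ℕ => Φ.dense ν g hg ((n : ENNReal) + 1)⁻¹ (by simp)
  refine ⟨fun n => ⟨p n, hp n⟩, ?_⟩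
  refine tendsto_of_tendsto_of_tendsto_of_le_of_le tendsto_const_nhds ?_ (fun _ => zero_le) hpg
  have := (ENNReal.tendsto_inv_nat_nhds_zero).comp (tendsto_add_atTop_nat 1)
  refine this.congr fun n => ?_
  simp

/-- Approximants of `g` that work for all vectors whose measure is dominated by `ν`. -/
theorem tendsto_apply {ν : Measure S} [IsFiniteMeasure ν] {g : S → ℂ} (hg : MemLp g 2 ν)
    {p : ℕ → Φ.alg} (hp : Tendsto (fun n => eLpNorm ((p n).1.1 - g) 2 ν) atTop (𝓝 0))
    {x : 𝓗} (hx : Φ.μ x ≤ ν) :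
    Tendsto (fun n => (p n).1.2 x) atTop (𝓝 (Φ.I x g)) := by
  have h1 : Tendsto (fun n => eLpNorm ((p n).1.1 - g) 2 (Φ.μ x)) atTop (𝓝 0) :=
    tendsto_of_tendsto_of_tendsto_of_le_of_le tendsto_const_nhds hp (fun _ => zero_le)
      fun n => eLpNorm_mono_measure _ hx
  refine (tendsto_I (fun n => (Φ.isBddMeas (p n)).memLp _) (hg.mono_measure hx) h1).congr fun n => ?_
  rw [I_alg]

/-- The calculus of a bounded function is linear in the vector: one sequence from the algebra
approximates the function in the `L²` spaces of all the vectors involved. -/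
theorem I_add_left (x y : 𝓗) {g : S → ℂ} (hg : IsBddMeas g) :
    Φ.I (x + y) g = Φ.I x g + Φ.I y g := by
  set ν := Φ.μ x + Φ.μ y + Φ.μ (x + y) with hν
  obtain ⟨p, hp⟩ := Φ.exists_seq ν (hg.memLp ν)
  have h1 := tendsto_apply (hg.memLp ν) hp
    (show Φ.μ x ≤ ν from (Measure.le_add_right le_rfl).trans (Measure.le_add_right le_rfl))
  have h2 := tendsto_apply (hg.memLp ν) hp
    (show Φ.μ y ≤ ν from (Measure.le_add_left le_rfl).trans (Measure.le_add_right le_rfl))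
  have h3 := tendsto_apply (hg.memLp ν) hp (show Φ.μ (x + y) ≤ ν from Measure.le_add_left le_rfl)
  refine tendsto_nhds_unique h3 ((h1.add h2).congr fun n => ?_)
  rw [map_add]

theorem I_smul_left (c : ℂ) (x : 𝓗) {g : S → ℂ} (hg : IsBddMeas g) :
    Φ.I (c • x) g = c • Φ.I x g := by
  set ν := Φ.μ x + Φ.μ (c • x) with hν
  obtain ⟨p, hp⟩ := Φ.exists_seq ν (hg.memLp ν)
  have h1 := tendsto_apply (hg.memLp ν) hp (show Φ.μ x ≤ ν from Measure.le_add_right le_rfl)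
  have h3 := tendsto_apply (hg.memLp ν) hp (show Φ.μ (c • x) ≤ ν from Measure.le_add_left le_rfl)
  refine tendsto_nhds_unique h3 ((h1.const_smul c).congr fun n => ?_)
  rw [map_smul]

theorem alg_apply_I (p : Φ.alg) (x : 𝓗) {u : S → ℂ} (hu : MemLp u 2 (Φ.μ x)) :
    p.1.2 (Φ.I x u) = Φ.I x (p.1.1 * u) := by
  obtain ⟨q, hq⟩ := Φ.exists_seq (Φ.μ x) hu
  have h1 : Tendsto (fun n => p.1.2 ((q n).1.2 x)) atTop (𝓝 (p.1.2 (Φ.I x u))) :=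
    (p.1.2.continuous.tendsto _).comp (tendsto_apply hu hq le_rfl)
  have hpb := Φ.isBddMeas p
  have h2 : Tendsto (fun n => Φ.I x (p.1.1 * (q n).1.1)) atTop (𝓝 (Φ.I x (p.1.1 * u))) := by
    refine tendsto_I (fun n => hpb.mul_memLp ((Φ.isBddMeas (q n)).memLp _)) (hpb.mul_memLp hu) ?_
    obtain ⟨C, hC⟩ := hpb.2
    have h3 : Tendsto (fun n => ENNReal.ofReal C * eLpNorm ((q n).1.1 - u) 2 (Φ.μ x)) atTop
        (𝓝 0) := by
      simpa using ENNReal.Tendsto.const_mul hq (Or.inr ENNReal.ofReal_ne_top)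
    refine tendsto_of_tendsto_of_tendsto_of_le_of_le tendsto_const_nhds h3 (fun _ => zero_le) ?_
    intro n
    refine eLpNorm_le_mul_eLpNorm_of_ae_le_mul (Eventually.of_forall fun s => ?_) 2
    simp only [Pi.sub_apply, Pi.mul_apply, ← mul_sub, norm_mul]
    gcongr
    exact hC s
  refine tendsto_nhds_unique h1 (h2.congr fun n => ?_)
  have h4 := I_alg ⟨p.1 * (q n).1, Φ.mul_mem _ p.2 _ (q n).2⟩ x
  exact h4

/-- Multiplicativity of the extended calculus: `g(T) u(T) x = (g u)(T) x`. -/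
theorem I_I (x : 𝓗) {g u : S → ℂ} (hg : IsBddMeas g) (hu : MemLp u 2 (Φ.μ x)) :
    Φ.I (Φ.I x u) g = Φ.I x (g * u) := by
  -- the measure `|u|² μ x` controls the approximation of `g u` in `L²(μ x)`
  set ρ := (Φ.μ x).withDensity (fun s => ‖u s‖ₑ ^ 2) with hρ
  have hρfin : IsFiniteMeasure ρ := by
    refine isFiniteMeasure_withDensity ?_
    rw [← eLpNorm_two_sq]
    exact ENNReal.pow_ne_top hu.2.ne
  set ν := Φ.μ (Φ.I x u) + ρ with hν
  obtain ⟨p, hp⟩ := Φ.exists_seq ν (hg.memLp ν)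
  have h1 := tendsto_apply (hg.memLp ν) hp
    (show Φ.μ (Φ.I x u) ≤ ν from Measure.le_add_right le_rfl)
  have h2 : Tendsto (fun n => Φ.I x ((p n).1.1 * u)) atTop (𝓝 (Φ.I x (g * u))) := by
    refine tendsto_I (fun n => (Φ.isBddMeas (p n)).mul_memLp hu) (hg.mul_memLp hu) ?_
    refine tendsto_of_tendsto_of_tendsto_of_le_of_le tendsto_const_nhds hp (fun _ => zero_le) ?_
    intro n
    refine le_trans ?_ (eLpNorm_mono_measure _ (show ρ ≤ ν from Measure.le_add_left le_rfl))
    refine (ENNReal.pow_right_strictMono (n := 2) (by norm_num)).le_iff_le.1 ?_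
    simp only
    rw [eLpNorm_two_sq, eLpNorm_two_sq, hρ,
      lintegral_withDensity_eq_lintegral_mul₀ (hu.1.enorm.pow_const 2)]
    · refine lintegral_mono fun s => le_of_eq ?_
      simp only [Pi.sub_apply, Pi.mul_apply, ← sub_mul, enorm_mul, mul_pow]
      rw [mul_comm]
    · exact (((Φ.isBddMeas (p n)).1.sub hg.1).enorm.pow_const 2).aemeasurable
  refine tendsto_nhds_unique h1 (h2.congr fun n => ?_)
  rw [alg_apply_I _ _ hu]

theorem inner_I_left (x y : 𝓗) {g : S → ℂ} (hg : IsBddMeas g) :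
    inner ℂ y (Φ.I x g) = inner ℂ (Φ.I y (star g)) x := by
  set ν := Φ.μ x + Φ.μ y with hν
  have hg' : IsBddMeas (star g) := ⟨Complex.continuous_conj.measurable.comp hg.1, by simpa using hg.2⟩
  obtain ⟨p, hp⟩ := Φ.exists_seq ν (hg.memLp ν)
  have h1 := tendsto_apply (hg.memLp ν) hp (show Φ.μ x ≤ ν from Measure.le_add_right le_rfl)
  have h2 := tendsto_apply (Φ := Φ) (x := y) (p := fun n => ⟨star (p n).1, Φ.star_mem _ (p n).2⟩)
    (hg'.memLp ν) (by
      refine hp.congr fun n => ?_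
      refine eLpNorm_congr_norm_ae (Eventually.of_forall fun s => ?_)
      change _ = ‖star ((p n).1.1 s) - star (g s)‖
      rw [← star_sub, norm_star]; rfl)
    (show Φ.μ y ≤ ν from Measure.le_add_left le_rfl)
  have h3 : Tendsto (fun n => inner ℂ y ((p n).1.2 x)) atTop (𝓝 (inner ℂ y (Φ.I x g))) :=
    tendsto_const_nhds.inner h1
  refine tendsto_nhds_unique h3 ((h2.inner tendsto_const_nhds).congr fun n => ?_)
  change inner ℂ ((ContinuousLinearMap.adjoint (p n).1.2) y) x = _
  rw [ContinuousLinearMap.adjoint_inner_left]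

theorem norm_I_le {x : 𝓗} {g : S → ℂ} (hg : IsBddMeas g) {C : ℝ} (hC0 : 0 ≤ C)
    (hC : ∀ s, ‖g s‖ ≤ C) (hx : Φ.I x 1 = x) : ‖Φ.I x g‖ ≤ C * ‖x‖ := by
  have h1 : IsBddMeas (1 : S → ℂ) := ⟨measurable_one, 1, fun s => by simp⟩
  have h2 : ‖Φ.I x g‖ₑ ≤ ENNReal.ofReal C * ‖x‖ₑ := by
    conv_rhs => rw [← hx]
    rw [enorm_I (hg.memLp _), enorm_I (h1.memLp _)]
    refine eLpNorm_le_mul_eLpNorm_of_ae_le_mul (Eventually.of_forall fun s => ?_) 2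
    simpa using hC s
  rw [← ofReal_norm, ← ofReal_norm, ← ENNReal.ofReal_mul hC0] at h2
  exact (ENNReal.ofReal_le_ofReal_iff (by positivity)).1 h2

end BorelCalculus

/-! ### The Borel functional calculus of a bounded normal operator -/

section Normal

open scoped CompactlySupported

variable {K : Type*} [TopologicalSpace K]

/-- A real continuous function, regarded as a complex one. -/
def ofRealMap (g : C(K, ℝ)) : C(K, ℂ) := ⟨fun s => ((g s : ℝ) : ℂ), by fun_prop⟩

theorem star_ofRealMap (g : C(K, ℝ)) : star (ofRealMap g) = ofRealMap g := by
  ext s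
  exact Complex.conj_ofReal _

theorem inner_map_ofRealMap (π : C(K, ℂ) →⋆ₐ[ℂ] (𝓗 →L[ℂ] 𝓗)) (g : C(K, ℝ)) (x : 𝓗) :
    inner ℂ x (π (ofRealMap g) x) = ((inner ℂ x (π (ofRealMap g) x)).re : ℂ) := by
  have h : ContinuousLinearMap.adjoint (π (ofRealMap g)) = π (ofRealMap g) := by
    rw [← ContinuousLinearMap.star_eq_adjoint, ← map_star, star_ofRealMap]
  refine (Complex.conj_eq_iff_re.1 ?_).symm
  rw [inner_conj_symm, ← ContinuousLinearMap.adjoint_inner_right, h]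

variable [CompactSpace K]

/-- The positive functional `g ↦ (π(g) x, x)` attached to a representation `π` of `C(K)`. -/
def vectorState (π : C(K, ℂ) →⋆ₐ[ℂ] (𝓗 →L[ℂ] 𝓗)) (x : 𝓗) : C_c(K, ℝ) →ₚ[ℝ] ℝ :=
  PositiveLinearMap.mk₀
    { toFun := fun g => (inner ℂ x (π (ofRealMap g.toContinuousMap) x)).re
      map_add' := fun g h => by
        have : ofRealMap (g + h).toContinuousMap =
            ofRealMap g.toContinuousMap + ofRealMap h.toContinuousMap := by
          ext s; exact Complex.ofReal_add _ _
        rw [this, map_add, _root_.add_apply, inner_add_right, Complex.add_re]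
      map_smul' := fun c g => by
        have : ofRealMap (c • g).toContinuousMap = (c : ℂ) • ofRealMap g.toContinuousMap := by
          ext s; exact Complex.ofReal_mul _ _
        rw [this, map_smul, _root_.smul_apply, inner_smul_right, Complex.re_ofReal_mul]
        rfl }
    (fun g hg => by
      let h : C(K, ℝ) := ⟨fun s => √(g s), by fun_prop⟩
      have : ofRealMap g.toContinuousMap = star (ofRealMap h) * ofRealMap h := by
        rw [star_ofRealMap]
        ext s
        change ((g s : ℝ) : ℂ) = ((√(g s) : ℝ) : ℂ) * ((√(g s) : ℝ) : ℂ)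
        rw [← Complex.ofReal_mul, Real.mul_self_sqrt (hg s)]
      change 0 ≤ (inner ℂ x (π (ofRealMap g.toContinuousMap) x)).re
      rw [this, map_mul, map_star]
      change 0 ≤ (inner ℂ x ((ContinuousLinearMap.adjoint (π (ofRealMap h)))
        (π (ofRealMap h) x))).re
      rw [ContinuousLinearMap.adjoint_inner_right]
      exact inner_self_nonneg (𝕜 := ℂ))

variable [MeasurableSpace K] [BorelSpace K] [T2Space K]

theorem integral_vectorState (π : C(K, ℂ) →⋆ₐ[ℂ] (𝓗 →L[ℂ] 𝓗)) (x : 𝓗) (g : C(K, ℝ)) :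
    ∫ s, g s ∂(RealRMK.rieszMeasure (vectorState π x)) =
      (inner ℂ x (π (ofRealMap g) x)).re :=
  RealRMK.integral_rieszMeasure (vectorState π x)
    (CompactlySupportedContinuousMap.continuousMapEquiv g)

/-- The functional calculus of continuous functions given by a representation of `C(K)`; the
representing measures come from the Riesz–Markov–Kakutani theorem. -/
def BorelCalculus.ofContinuous {K : Type*} [MetricSpace K] [CompactSpace K] [MeasurableSpace K]
    [BorelSpace K] (π : C(K, ℂ) →⋆ₐ[ℂ] (𝓗 →L[ℂ] 𝓗)) : BorelCalculus 𝓗 K where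
  alg := LinearMap.range
    ({ toFun := fun f => (⇑f, π f)
       map_add' := fun f g => by rw [map_add]; rfl
       map_smul' := fun c g => by rw [map_smul]; rfl } :
      C(K, ℂ) →ₗ[ℂ] (K → ℂ) × (𝓗 →L[ℂ] 𝓗))
  μ x := RealRMK.rieszMeasure (vectorState π x)
  finite x := inferInstance
  mul_mem := by
    rintro _ ⟨f, rfl⟩ _ ⟨g, rfl⟩
    refine ⟨f * g, ?_⟩
    change (⇑(f * g), π (f * g)) = _
    rw [map_mul]; rfl
  star_mem := by
    rintro _ ⟨f, rfl⟩
    refine ⟨star f, ?_⟩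
    change (⇑(star f), π (star f)) = _
    rw [map_star]; rfl
  measurable := by
    rintro _ ⟨f, rfl⟩
    exact f.continuous.measurable
  bounded := by
    rintro _ ⟨f, rfl⟩
    exact ⟨‖f‖, fun s => f.norm_coe_le_norm s⟩
  inner_eq := by
    rintro _ ⟨f, rfl⟩ x
    set ν := RealRMK.rieszMeasure (vectorState π x)
    change inner ℂ x (π f x) = ∫ s, f s ∂ν
    let g : C(K, ℝ) := ⟨fun s => (f s).re, by fun_prop⟩
    let h : C(K, ℝ) := ⟨fun s => (f s).im, by fun_prop⟩
    have hf : f = ofRealMap g + Complex.I • ofRealMap h := by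
      ext s
      change f s = ((f s).re : ℂ) + Complex.I * ((f s).im : ℂ)
      rw [mul_comm, Complex.re_add_im]
    have hint : Integrable (fun s => f s) ν :=
      Integrable.of_bound f.continuous.aestronglyMeasurable ‖f‖
        (Eventually.of_forall fun s => f.norm_coe_le_norm s)
    have hre : ∫ s, (f s).re ∂ν = _ := integral_vectorState π x g
    have him : ∫ s, (f s).im ∂ν = _ := integral_vectorState π x h
    rw [← integral_re_add_im hint]
    simp only [RCLike.re_to_complex, RCLike.im_to_complex, hre, him]
    conv_lhs => rw [hf]
    rw [map_add, map_smul, _root_.add_apply, _root_.smul_apply,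
      inner_add_right, inner_smul_right, inner_map_ofRealMap π g, inner_map_ofRealMap π h, mul_comm]
    rfl
  dense := by
    intro ν _ g hg ε hε
    obtain ⟨u, hu, -⟩ := hg.exists_boundedContinuous_eLpNorm_sub_le (by norm_num) hε
    refine ⟨_, ⟨u.toContinuousMap, rfl⟩, ?_⟩
    rw [← eLpNorm_neg, neg_sub]
    exact hu

end Normal

/-! ### The projection-valued measure of a Borel calculus -/

namespace BorelCalculus

variable {S : Type*} [MeasurableSpace S] {Φ : BorelCalculus 𝓗 S}

theorem isBddMeas_one : IsBddMeas (1 : S → ℂ) := ⟨measurable_one, 1, fun s => by simp⟩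

theorem μ_apply (x : 𝓗) {A : Set S} (hA : MeasurableSet A) :
    Φ.μ x A = ‖Φ.I x (A.indicator 1)‖ₑ ^ 2 := by
  rw [enorm_I_sq ((IsBddMeas.indicator_one hA).memLp _), ← lintegral_indicator_one hA]
  refine lintegral_congr fun s => ?_
  by_cases h : s ∈ A <;> simp [h]

/-- The measure of the vector `u(T) x` is `|u|² μ x`. -/
theorem μ_I (x : 𝓗) {u : S → ℂ} (hu : MemLp u 2 (Φ.μ x)) :
    Φ.μ (Φ.I x u) = (Φ.μ x).withDensity (fun s => ‖u s‖ₑ ^ 2) := by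
  ext A hA
  have hb := IsBddMeas.indicator_one (S := S) hA
  rw [μ_apply _ hA, I_I x hb hu, enorm_I_sq (hb.mul_memLp hu), withDensity_apply _ hA,
    ← lintegral_indicator hA]
  refine lintegral_congr fun s => ?_
  by_cases h : s ∈ A <;> simp [h]

theorem I_zero (x : 𝓗) : Φ.I x 0 = 0 := by
  have h := I_smul (Φ := Φ) (x := x) (g := (0 : S → ℂ)) MemLp.zero 0
  simpa using h

/-- The bounded operator `g(T)`, for a bounded measurable function `g`. -/
def op (hone : ∀ x, Φ.I x 1 = x) {g : S → ℂ} (hg : IsBddMeas g) : 𝓗 →L[ℂ] 𝓗 :=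
  LinearMap.mkContinuous
    { toFun := fun x => Φ.I x g
      map_add' := fun x y => I_add_left x y hg
      map_smul' := fun a x => I_smul_left a x hg } (max hg.2.choose 0)
    (fun x => norm_I_le hg (le_max_right _ _)
      (fun s => (hg.2.choose_spec s).trans (le_max_left _ _)) (hone x))

/-- A bounded Borel calculus on `S` and a Borel function `c` on `S` give a projection-valued
measure on the line, the spectral measure of `c(T)`. -/
theorem exists_projectionMeasure (hone : ∀ x, Φ.I x 1 = x) {c : S → ℝ} (hc : Measurable c) :
    ∃ E : ProjectionMeasure 𝓗, ∀ X, MeasurableSet X → ∀ x,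
      E.toFun X x = Φ.I x ((c ⁻¹' X).indicator 1) := by
  classical
  have hb : ∀ X, MeasurableSet X → IsBddMeas ((c ⁻¹' X).indicator (1 : S → ℂ)) :=
    fun X hX => IsBddMeas.indicator_one (hc hX)
  let T : ∀ X, MeasurableSet X → 𝓗 →L[ℂ] 𝓗 := fun X hX => op hone (hb X hX)
  have hT : ∀ X hX x, T X hX x = Φ.I x ((c ⁻¹' X).indicator 1) := fun X hX x => rfl
  refine ⟨{ toFun := fun X => if hX : MeasurableSet X then T X hX else 0
            isStarProjection := ?_
            univ := ?_
            hasSum := ?_ }, ?_⟩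
  · intro X hX
    rw [dif_pos hX]
    refine ⟨?_, ?_⟩
    · ext x
      change T X hX (T X hX x) = T X hX x
      rw [hT X hX, hT X hX, I_I x (hb X hX) ((hb X hX).memLp _)]
      congr 1
      ext s
      by_cases h : s ∈ c ⁻¹' X <;> simp [h]
    · refine ContinuousLinearMap.isSelfAdjoint_iff_isSymmetric.2 fun x y => ?_
      change inner ℂ (T X hX x) y = inner ℂ x (T X hX y)
      rw [hT X hX, hT X hX, inner_I_left y x (hb X hX)]
      congr 2
      ext s
      by_cases h : s ∈ c ⁻¹' X <;> simp [h]
  · rw [dif_pos MeasurableSet.univ]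
    ext x
    rw [hT _ MeasurableSet.univ, Set.preimage_univ, Set.indicator_univ, hone]; rfl
  · intro X hX hd x
    have hU : MeasurableSet (⋃ n, X n) := MeasurableSet.iUnion hX
    simp only [dif_pos hU, dif_pos (hX _), hT]
    set Y : ℕ → Set S := fun n => c ⁻¹' X n with hY
    have hYm : ∀ n, MeasurableSet (Y n) := fun n => hc (hX n)
    have hYd : Pairwise (fun m n => Disjoint (Y m) (Y n)) := fun m n h => (hd h).preimage c
    rw [Set.preimage_iUnion]
    have hfin : ∀ s : Finset ℕ, Φ.I x ((⋃ n ∈ s, Y n).indicator 1) =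
        ∑ n ∈ s, Φ.I x ((Y n).indicator 1) := by
      intro s
      induction s using Finset.induction_on with
      | empty =>
        rw [show (⋃ n ∈ (∅ : Finset ℕ), Y n).indicator (1 : S → ℂ) = 0 by ext; simp, I_zero,
          Finset.sum_empty]
      | insert n s hn ih =>
        have hm : MeasurableSet (⋃ m ∈ s, Y m) := Finset.measurableSet_biUnion s fun m _ => hYm m
        have hdis : Disjoint (Y n) (⋃ m ∈ s, Y m) :=
          Set.disjoint_iUnion₂_right.2 fun m hm => hYd fun h => hn (h ▸ hm)
        rw [Finset.sum_insert hn, ← ih, Finset.set_biUnion_insert,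
          Set.indicator_union_of_disjoint hdis]
        exact I_add ((IsBddMeas.indicator_one (hYm n)).memLp _)
          ((IsBddMeas.indicator_one hm).memLp _)
    -- by orthogonality the remainder of the series is the measure of the remaining sets
    have hrest : ∀ s : Finset ℕ, edist (∑ n ∈ s, Φ.I x ((Y n).indicator 1))
        (Φ.I x ((⋃ n, Y n).indicator 1)) ^ 2 = ∑' b : {n // n ∉ s}, Φ.μ x (Y b) := by
      intro s
      have hm : MeasurableSet (⋃ m ∈ s, Y m) := Finset.measurableSet_biUnion s fun m _ => hYm m
      have hm' : MeasurableSet (⋃ b : {n // n ∉ s}, Y b) := MeasurableSet.iUnion fun b => hYm b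
      have hdis : Disjoint (⋃ m ∈ s, Y m) (⋃ b : {n // n ∉ s}, Y b) :=
        Set.disjoint_iUnion_right.2 fun b => Set.disjoint_iUnion₂_left.2 fun m hm =>
          hYd fun h => b.2 (h ▸ hm)
      have hun : (⋃ n, Y n) = (⋃ m ∈ s, Y m) ∪ ⋃ b : {n // n ∉ s}, Y b := by
        ext z
        simp only [Set.mem_iUnion, Set.mem_union, Subtype.exists, exists_prop]
        constructor
        · rintro ⟨n, hn⟩
          by_cases h : n ∈ s
          · exact Or.inl ⟨n, h, hn⟩
          · exact Or.inr ⟨n, h, hn⟩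
        · rintro (⟨n, -, hn⟩ | ⟨n, -, hn⟩) <;> exact ⟨n, hn⟩
      have h1 : Φ.I x ((⋃ n, Y n).indicator 1) = Φ.I x ((⋃ m ∈ s, Y m).indicator 1) +
          Φ.I x ((⋃ b : {n // n ∉ s}, Y b).indicator 1) := by
        rw [hun, Set.indicator_union_of_disjoint hdis]
        exact I_add ((IsBddMeas.indicator_one hm).memLp _) ((IsBddMeas.indicator_one hm').memLp _)
      rw [← hfin, h1, edist_comm, edist_eq_enorm_sub, add_sub_cancel_left, ← μ_apply x hm',
        measure_iUnion (fun a b h => hYd fun h' => h (Subtype.ext h')) (fun b => hYm b)]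
    rw [HasSum, tendsto_iff_edist_tendsto_0, SummationFilter.unconditional_filter]
    have hlim : Tendsto (fun s : Finset ℕ => edist (∑ n ∈ s, Φ.I x ((Y n).indicator 1))
        (Φ.I x ((⋃ n, Y n).indicator 1)) ^ 2) atTop (𝓝 0) := by
      simp only [hrest]
      refine ENNReal.tendsto_tsum_compl_atTop_zero (f := fun n => Φ.μ x (Y n)) ?_
      rw [← measure_iUnion hYd hYm]
      exact measure_ne_top _ _
    have h2 := hlim.ennrpow_const (1 / 2 : ℝ)
    rw [ENNReal.zero_rpow_of_pos (by norm_num)] at h2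
    refine h2.congr fun s => ?_
    rw [← ENNReal.rpow_natCast, ← ENNReal.rpow_mul]
    norm_num
    rfl
  · intro X hX x
    simp only [dif_pos hX, hT]

end BorelCalculus

/-! ### Existence of the spectral measure -/

section SpectralTheorem

variable {H : 𝓗 →ₗ.[ℂ] 𝓗}

/-- The resolvent `R = (H + i)⁻¹` exists as a bounded operator, and the Cayley transform
`1 - 2iR = (H - i)(H + i)⁻¹` is unitary. -/
theorem exists_resolvent (hH : IsSelfAdjoint H) : ∃ R : 𝓗 →L[ℂ] 𝓗,
    (∀ y, ∃ f : H.domain, (f : 𝓗) = R y ∧ H f + Complex.I • (f : 𝓗) = y) ∧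
    (∀ f : H.domain, R (H f + Complex.I • (f : 𝓗)) = f) ∧
    (1 - (2 * Complex.I) • R) ∈ unitary (𝓗 →L[ℂ] 𝓗) := by
  have hsurj : ∀ y, ∃ f : H.domain, H f + Complex.I • (f : 𝓗) = y := fun y => by
    simpa using exists_apply_add_smul_eq hH 0 one_ne_zero y
  have hsurj' : ∀ y, ∃ f : H.domain, H f - Complex.I • (f : 𝓗) = y := fun y => by
    simpa [sub_eq_add_neg] using exists_apply_add_smul_eq hH 0 (b := -1) (by norm_num) y
  have hn : ∀ f : H.domain, ‖(f : 𝓗)‖ ≤ ‖H f + Complex.I • (f : 𝓗)‖ := by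
    intro f
    have h1 := norm_apply_add_smul_sq hH 0 1 f
    simp only [Complex.ofReal_zero, zero_add, Complex.ofReal_one, one_mul, zero_smul, add_zero,
      one_pow] at h1
    refine abs_le_of_sq_le_sq' ?_ (norm_nonneg _) |>.2
    rw [h1]
    nlinarith [sq_nonneg ‖H f‖]
  have hinj : ∀ f g : H.domain, H f + Complex.I • (f : 𝓗) = H g + Complex.I • (g : 𝓗) → f = g := by
    intro f g h
    have h1 := hn (f - g)
    have h2 : H (f - g) + Complex.I • ((f - g : H.domain) : 𝓗) = 0 := by
      rw [LinearPMap.map_sub, Submodule.coe_sub, smul_sub]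
      rw [← sub_eq_zero] at h
      rw [← h]; abel
    rw [h2, norm_zero] at h1
    exact sub_eq_zero.1 (Subtype.ext (norm_le_zero_iff.1 h1))
  choose r hr using hsurj
  let R : 𝓗 →L[ℂ] 𝓗 := LinearMap.mkContinuous
    { toFun := fun y => (r y : 𝓗)
      map_add' := fun x y => by
        have : r (x + y) = r x + r y := hinj _ _ (by
          rw [hr, LinearPMap.map_add, Submodule.coe_add, smul_add, add_add_add_comm, hr, hr])
        rw [this]; rfl
      map_smul' := fun c y => by
        have : r (c • y) = c • r y := hinj _ _ (by
          rw [hr, LinearPMap.map_smul, Submodule.coe_smul, smul_comm Complex.I c, ← smul_add, hr])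
        rw [this]; rfl } 1
    (fun y => by
      have := hn (r y)
      rw [hr] at this
      simpa using this)
  have hR : ∀ y, R y = r y := fun y => rfl
  have hRl : ∀ f : H.domain, r (H f + Complex.I • (f : 𝓗)) = f := fun f => hinj _ _ (hr _)
  have hV : ∀ y, (1 - (2 * Complex.I) • R) y = H (r y) - Complex.I • (r y : 𝓗) := by
    intro y
    change y - (2 * Complex.I) • R y = _
    rw [hR]
    conv_lhs => enter [1]; rw [← hr y]
    rw [mul_smul, two_smul]; abel
  refine ⟨R, fun y => ⟨r y, rfl, hr y⟩, fun f => by rw [hR, hRl], ?_⟩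
  let e : 𝓗 ≃ₗᵢ[ℂ] 𝓗 := LinearIsometryEquiv.ofSurjective
    ⟨(1 - (2 * Complex.I) • R).toLinearMap, fun y => by
      change ‖(1 - (2 * Complex.I) • R) y‖ = ‖y‖
      rw [hV, ← norm_apply_add_I_smul hH, hr]⟩
    (fun y => by
      obtain ⟨f, hf⟩ := hsurj' y
      refine ⟨H f + Complex.I • (f : 𝓗), ?_⟩
      change (1 - (2 * Complex.I) • R) _ = y
      rw [hV, hRl, hf])
  have he := (Unitary.linearIsometryEquiv.symm e).2
  exact he

/-- The spectral theorem: a self-adjoint operator has a spectral measure. -/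
theorem exists_isSpectralMeasureOf (hH : IsSelfAdjoint H) :
    ∃ E : ProjectionMeasure 𝓗, E.IsSpectralMeasureOf H := by
  obtain ⟨R, hR1, hR2, hV⟩ := exists_resolvent hH
  set V : 𝓗 →L[ℂ] 𝓗 := 1 - (2 * Complex.I) • R with hVdef
  have hVn : IsStarNormal V := isStarNormal_of_mem_unitary hV
  set π := cfcHom (R := ℂ) hVn with hπ
  set Φ := BorelCalculus.ofContinuous π with hΦ
  have hcont : ∀ f : C(spectrum ℂ V, ℂ), ∀ x, Φ.I x f = π f x := fun f x =>
    BorelCalculus.I_alg (Φ := Φ) ⟨(⇑f, π f), ⟨f, rfl⟩⟩ x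
  have hone : ∀ x, Φ.I x 1 = x := by
    intro x
    have := hcont 1 x
    rw [map_one] at this
    exact this
  -- `r` is the symbol of the resolvent and `c` that of `H`
  let r : spectrum ℂ V → ℂ := fun z => (1 - (z : ℂ)) / (2 * Complex.I)
  let c : spectrum ℂ V → ℝ := fun z => (Complex.I * (1 + (z : ℂ)) / (1 - (z : ℂ))).re
  have hcm : Measurable c := by
    apply Complex.measurable_re.comp
    fun_prop
  have hrm : Measurable r := by fun_prop
  have hrR : ∀ y, Φ.I y r = R y := by
    intro y
    have h1 := hcont ((2 * Complex.I)⁻¹ •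
      (1 - (ContinuousMap.id ℂ).restrict (spectrum ℂ V))) y
    rw [map_smul, map_sub, map_one, hπ, cfcHom_id] at h1
    have h2 : ((2 * Complex.I)⁻¹ • (1 - V)) y = R y := by
      rw [hVdef, sub_sub_cancel, smul_smul, inv_mul_cancel₀ (by simp), one_smul]
    rw [h2] at h1
    rw [← h1]
    congr 1
    ext z
    change (1 - (z : ℂ)) / (2 * Complex.I) = (2 * Complex.I)⁻¹ * (1 - (z : ℂ))
    rw [div_eq_inv_mul]
  have hnorm : ∀ z : spectrum ℂ V, ‖(z : ℂ)‖ = 1 := fun z => by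
    simpa using spectrum.subset_circle_of_unitary hV z.2
  have hcr : ∀ z : spectrum ℂ V, (z : ℂ) ≠ 1 → ((c z : ℂ) + Complex.I) * r z = 1 := by
    intro z hz
    have hz' : (1 : ℂ) - z ≠ 0 := sub_ne_zero.2 (Ne.symm hz)
    -- the inverse Cayley transform is real on the unit circle
    have hcz : (c z : ℂ) = Complex.I * (1 + (z : ℂ)) / (1 - (z : ℂ)) := by
      refine Complex.conj_eq_iff_re.1 ?_
      have h1 : (starRingEnd ℂ) (z : ℂ) = (z : ℂ)⁻¹ := by
        rw [Complex.inv_def, Complex.normSq_eq_norm_sq, hnorm z]; simp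
      have h0 : (z : ℂ) ≠ 0 := by
        intro h
        have := hnorm z
        rw [h] at this; simp at this
      have h2 : (z : ℂ) - 1 ≠ 0 := sub_ne_zero.2 hz
      simp only [map_div₀, map_mul, map_add, map_sub, map_one, Complex.conj_I, h1]
      have h3 : 1 - (z : ℂ)⁻¹ ≠ 0 := by
        intro h
        apply hz
        have : (z : ℂ)⁻¹ = 1 := (sub_eq_zero.1 h).symm
        simpa using this
      rw [div_eq_div_iff h3 hz']
      field_simp
      ring
    rw [hcz]
    simp only [r]
    field_simp
    ring
  have hrb : IsBddMeas r := by
    refine ⟨hrm, 1, fun z => ?_⟩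
    simp only [r, norm_div, norm_mul, Complex.norm_I, Complex.norm_ofNat, mul_one]
    rw [div_le_one (by norm_num)]
    calc ‖1 - (z : ℂ)‖ ≤ ‖(1 : ℂ)‖ + ‖(z : ℂ)‖ := norm_sub_le _ _
      _ = 2 := by rw [hnorm z]; norm_num
  have hRinj : ∀ y, R y = 0 → y = 0 := by
    intro y hy
    obtain ⟨f, hf1, hf2⟩ := hR1 y
    have : f = 0 := Subtype.ext (hf1.trans hy)
    rw [← hf2, this, LinearPMap.map_zero]; simp
  -- `1` is not an eigenvalue of the Cayley transform, as `R` is injective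
  have hnull : ∀ x, ∀ᵐ z : spectrum ℂ V ∂(Φ.μ x), (z : ℂ) ≠ 1 := by
    intro x
    let A : Set (spectrum ℂ V) := {z : spectrum ℂ V | (z : ℂ) = 1}
    have hAm : MeasurableSet A := measurableSet_eq_fun (by fun_prop) (by fun_prop)
    have hAb := IsBddMeas.indicator_one hAm
    have h1 : Φ.I x (A.indicator 1) = 0 := by
      apply hRinj
      rw [← hrR, BorelCalculus.I_I x hrb (hAb.memLp _), ← BorelCalculus.I_zero (Φ := Φ) x]
      congr 1
      ext z
      by_cases h : z ∈ A
      · have : (z : ℂ) = 1 := h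
        simp [r, this]
      · simp [h]
    have h2 : Φ.μ x A = 0 := by rw [BorelCalculus.μ_apply x hAm, h1]; simp
    rw [ae_iff]
    simpa using h2
  obtain ⟨E, hE⟩ := BorelCalculus.exists_projectionMeasure hone hcm
  have hEμ : ∀ f, E.scalarMeasure f = (Φ.μ f).map c := by
    intro f
    ext X hX
    rw [E.scalarMeasure_apply f hX, Measure.map_apply hcm hX, BorelCalculus.μ_apply f (hcm hX),
      hE X hX, ENNReal.ofReal_pow (norm_nonneg _), ofReal_norm]
  have hlint : ∀ f, ∫⁻ l, ‖l‖ₑ ^ 2 ∂(E.scalarMeasure f) = ∫⁻ z, ‖(c z : ℂ)‖ₑ ^ 2 ∂(Φ.μ f) := by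
    intro f
    rw [hEμ, lintegral_map (by fun_prop) hcm]
    refine lintegral_congr fun z => ?_
    rw [← ofReal_norm, ← ofReal_norm, Complex.norm_real]
  -- for `f = R g` the measure of `f` is `|r|²` times that of `g`, and `|c r| ≤ 1`
  have hdom : ∀ f, f ∈ H.domain → ∫⁻ l, ‖l‖ₑ ^ 2 ∂(E.scalarMeasure f) < ⊤ := by
    intro f hf
    set g := H ⟨f, hf⟩ + Complex.I • f with hg
    have hfg : f = Φ.I g r := by rw [hrR]; exact (hR2 ⟨f, hf⟩).symm
    rw [hlint]
    conv_lhs => rw [hfg]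
    rw [BorelCalculus.μ_I g (hrb.memLp _),
      lintegral_withDensity_eq_lintegral_mul _ (hrm.enorm.pow_const 2) (by fun_prop)]
    refine lt_of_le_of_lt (lintegral_mono_ae (g := fun _ => 1) ?_) (by simp)
    filter_upwards [hnull g] with z hz
    have h1 : ‖(c z : ℂ)‖ ^ 2 * ‖r z‖ ^ 2 ≤ 1 := by
      have h2 : ‖(c z : ℂ)‖ ^ 2 ≤ ‖(c z : ℂ) + Complex.I‖ ^ 2 := by
        rw [← Complex.normSq_eq_norm_sq, ← Complex.normSq_eq_norm_sq, Complex.normSq_apply,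
          Complex.normSq_apply]
        simp
      calc _ ≤ ‖(c z : ℂ) + Complex.I‖ ^ 2 * ‖r z‖ ^ 2 := by gcongr
        _ = 1 := by rw [← mul_pow, ← norm_mul, hcr z hz]; simp
    simp only [Pi.mul_apply]
    rw [mul_comm, ← ofReal_norm, ← ofReal_norm, ← ENNReal.ofReal_pow (norm_nonneg _),
      ← ENNReal.ofReal_pow (norm_nonneg _), ← ENNReal.ofReal_mul (by positivity)]
    exact ENNReal.ofReal_le_one.2 h1
  -- conversely `f = R g` for `g = (c + i)(T) f`, which exists if `c` is square integrable
  have hconv : ∀ f, ∫⁻ l, ‖l‖ₑ ^ 2 ∂(E.scalarMeasure f) < ⊤ →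
      ∃ h : f ∈ H.domain, inner ℂ f (H ⟨f, h⟩) = ((∫ l, l ∂(E.scalarMeasure f) : ℝ) : ℂ) := by
    intro f hf
    rw [hlint] at hf
    have hcL : MemLp (fun z => (c z : ℂ)) 2 (Φ.μ f) := by
      refine ⟨(Complex.measurable_ofReal.comp hcm).aestronglyMeasurable, ?_⟩
      rw [← BorelCalculus.eLpNorm_two_sq] at hf
      by_contra h
      rw [not_lt, top_le_iff] at h
      simp [h] at hf
    have h1L : MemLp (1 : spectrum ℂ V → ℂ) 2 (Φ.μ f) := BorelCalculus.isBddMeas_one.memLp _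
    have huL := hcL.add (h1L.const_smul Complex.I)
    set g := Φ.I f ((fun z => (c z : ℂ)) + Complex.I • (1 : spectrum ℂ V → ℂ)) with hg
    have hRg : R g = f := by
      rw [← hrR, hg, BorelCalculus.I_I f hrb huL]
      refine (BorelCalculus.I_congr (hrb.mul_memLp huL) ?_).trans (hone f)
      filter_upwards [hnull f] with z hz
      have := hcr z hz
      rw [mul_comm] at this
      simpa using this
    obtain ⟨f', hf1, hf2⟩ := hR1 g
    rw [hRg] at hf1
    have hmem : f ∈ H.domain := hf1 ▸ f'.2
    have hff : f' = ⟨f, hmem⟩ := Subtype.ext hf1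
    refine ⟨hmem, ?_⟩
    have hHf : H ⟨f, hmem⟩ = Φ.I f (fun z => (c z : ℂ)) := by
      rw [hg, BorelCalculus.I_add hcL (h1L.const_smul _), BorelCalculus.I_smul h1L, hone, hff] at hf2
      exact add_right_cancel hf2
    rw [hHf]
    conv_lhs => enter [2]; rw [← hone f]
    rw [BorelCalculus.inner_I h1L hcL, hEμ, integral_map hcm.aemeasurable (by fun_prop)]
    simp only [Pi.one_apply, map_one, mul_one]
    exact integral_complex_ofReal
  refine ⟨E, fun f => ⟨hdom f, fun h => (hconv f h).1⟩, fun f => ?_⟩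
  obtain ⟨h, hh⟩ := hconv f (hdom f f.2)
  exact hh

end SpectralTheorem

/-! ### The Borel functional calculus of a projection-valued measure -/

namespace ProjectionMeasure

variable (E : ProjectionMeasure 𝓗)

theorem toFun_union {X Y : Set ℝ} (hX : MeasurableSet X) (hY : MeasurableSet Y)
    (hXY : Disjoint X Y) (f : 𝓗) : E.toFun (X ∪ Y) f = E.toFun X f + E.toFun Y f := by
  -- countable additivity for the sequence `X, Y, ∅, ∅, …`
  let Z : ℕ → Set ℝ := fun n => if n = 0 then X else if n = 1 then Y else ∅
  have hZm : ∀ n, MeasurableSet (Z n) := by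
    intro n
    simp only [Z]
    split_ifs
    exacts [hX, hY, MeasurableSet.empty]
  have hZd : Pairwise (fun m n => Disjoint (Z m) (Z n)) := by
    intro m n hmn
    simp only [Z]
    split_ifs <;> first | omega | exact hXY | exact hXY.symm | simp
  have hZu : (⋃ n, Z n) = X ∪ Y := by
    ext l
    simp only [Set.mem_iUnion, Set.mem_union, Z]
    constructor
    · rintro ⟨n, hn⟩
      split_ifs at hn
      exacts [Or.inl hn, Or.inr hn, absurd hn (Set.notMem_empty _)]
    · rintro (h | h)
      exacts [⟨0, by simpa using h⟩, ⟨1, by simpa using h⟩]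
  have h1 := E.hasSum Z hZm hZd f
  rw [hZu] at h1
  have h2 : HasSum (fun n => E.toFun (Z n) f) (∑ n ∈ Finset.range 2, E.toFun (Z n) f) := by
    refine hasSum_sum_of_ne_finset_zero fun n hn => ?_
    have h0 : n ≠ 0 ∧ n ≠ 1 := by
      simp only [Finset.mem_range] at hn
      omega
    simp only [Z, h0.1, h0.2, if_false]
    exact E.empty f
  rw [h1.unique h2, Finset.sum_range_succ, Finset.sum_range_one]
  simp [Z]

/-- Disjoint Borel sets have orthogonal projections, because the sum of their projections is again
a projection. -/
theorem toFun_apply_of_disjoint {X Y : Set ℝ} (hX : MeasurableSet X) (hY : MeasurableSet Y)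
    (hXY : Disjoint X Y) (f : 𝓗) : E.toFun X (E.toFun Y f) = 0 := by
  have hidem : E.toFun Y (E.toFun Y f) = E.toFun Y f :=
    congrArg (fun T : 𝓗 →L[ℂ] 𝓗 => T f) (E.isStarProjection Y hY).isIdempotentElem
  set g := E.toFun Y f with hg
  have h1 := E.inner_self_eq (hX.union hY) g
  rw [E.toFun_union hX hY hXY g, inner_add_right, Complex.add_re, E.inner_self_eq hX,
    E.inner_self_eq hY, hidem, @norm_add_sq ℂ, ← inner_conj_symm] at h1
  have h2 : RCLike.re ((starRingEnd ℂ) (inner ℂ g (E.toFun X g))) = ‖E.toFun X g‖ ^ 2 := by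
    rw [RCLike.conj_re]
    exact E.inner_self_eq hX g
  rw [h2] at h1
  have h3 : ‖E.toFun X g‖ ^ 2 = 0 := by linarith
  simpa using h3

theorem toFun_apply_toFun {X Y : Set ℝ} (hX : MeasurableSet X) (hY : MeasurableSet Y) (f : 𝓗) :
    E.toFun X (E.toFun Y f) = E.toFun (X ∩ Y) f := by
  have hidem : E.toFun (X ∩ Y) (E.toFun (X ∩ Y) f) = E.toFun (X ∩ Y) f :=
    congrArg (fun T : 𝓗 →L[ℂ] 𝓗 => T f) (E.isStarProjection _ (hX.inter hY)).isIdempotentElem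
  have hY' : E.toFun Y f = E.toFun (X ∩ Y) f + E.toFun (Y \ X) f := by
    rw [← E.toFun_union (hX.inter hY) (hY.diff hX)
      (Set.disjoint_left.2 fun l h h' => h'.2 h.1), Set.inter_comm, Set.inter_union_sdiff]
  have hX' : ∀ g, E.toFun X g = E.toFun (X ∩ Y) g + E.toFun (X \ Y) g := fun g => by
    rw [← E.toFun_union (hX.inter hY) (hX.diff hY)
      (Set.disjoint_left.2 fun l h h' => h'.2 h.2), Set.inter_union_sdiff]
  rw [hY', map_add, E.toFun_apply_of_disjoint hX (hY.diff hX) Set.disjoint_sdiff_right, add_zero,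
    hX', hidem, E.toFun_apply_of_disjoint (hX.diff hY) (hX.inter hY)
      (Set.disjoint_left.2 fun l h h' => h.2 h'.2), add_zero]

theorem scalarMeasure_univ (f : 𝓗) : E.scalarMeasure f Set.univ = ENNReal.ofReal (‖f‖ ^ 2) := by
  rw [E.scalarMeasure_apply f MeasurableSet.univ, E.univ]; rfl

instance (f : 𝓗) : IsFiniteMeasure (E.scalarMeasure f) :=
  ⟨by rw [scalarMeasure_univ]; exact ENNReal.ofReal_lt_top⟩

/-- The functional calculus of simple functions given by a projection-valued measure. -/
def borelCalculus : BorelCalculus 𝓗 ℝ where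
  alg := Submodule.span ℂ {p | ∃ X, MeasurableSet X ∧ p = (X.indicator 1, E.toFun X)}
  μ := E.scalarMeasure
  finite := inferInstance
  mul_mem := by
    intro p hp q hq
    refine Submodule.span_induction₂ (p := fun p q _ _ => p * q ∈ Submodule.span ℂ
      {p | ∃ X, MeasurableSet X ∧ p = (X.indicator 1, E.toFun X)}) ?_ ?_ ?_ ?_ ?_ ?_ ?_ hp hq
    · rintro _ _ ⟨X, hX, rfl⟩ ⟨Y, hY, rfl⟩
      refine Submodule.subset_span ⟨X ∩ Y, hX.inter hY, Prod.ext ?_ ?_⟩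
      · ext l
        by_cases h1 : l ∈ X <;> by_cases h2 : l ∈ Y <;> simp [h1, h2]
      · ext f
        exact E.toFun_apply_toFun hX hY f
    · intro q _
      rw [zero_mul]; exact zero_mem _
    · intro q _
      rw [mul_zero]; exact zero_mem _
    · intro x y z _ _ _ h1 h2
      rw [add_mul]; exact add_mem h1 h2
    · intro x y z _ _ _ h1 h2
      rw [mul_add]; exact add_mem h1 h2
    · intro r x y _ _ h
      rw [smul_mul_assoc]; exact Submodule.smul_mem _ _ h
    · intro r x y _ _ h
      rw [mul_smul_comm]; exact Submodule.smul_mem _ _ h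
  star_mem := by
    intro p hp
    induction hp using Submodule.span_induction with
    | mem p hp =>
      obtain ⟨X, hX, rfl⟩ := hp
      refine Submodule.subset_span ⟨X, hX, Prod.ext ?_ (E.isStarProjection X hX).isSelfAdjoint⟩
      ext l
      by_cases h1 : l ∈ X <;> simp [h1]
    | zero => rw [star_zero]; exact zero_mem _
    | add p q _ _ h1 h2 => rw [star_add]; exact add_mem h1 h2
    | smul c p _ h => rw [star_smul]; exact Submodule.smul_mem _ _ h
  measurable := by
    intro p hp
    induction hp using Submodule.span_induction with
    | mem p hp =>
      obtain ⟨X, hX, rfl⟩ := hp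
      exact measurable_one.indicator hX
    | zero => exact measurable_zero
    | add p q _ _ h1 h2 => exact h1.add h2
    | smul c p _ h => exact h.const_smul c
  bounded := by
    intro p hp
    induction hp using Submodule.span_induction with
    | mem p hp =>
      obtain ⟨X, hX, rfl⟩ := hp
      exact (IsBddMeas.indicator_one hX).2
    | zero => exact ⟨0, fun s => by simp⟩
    | add p q _ _ h1 h2 =>
      obtain ⟨C, hC⟩ := h1
      obtain ⟨D, hD⟩ := h2
      exact ⟨C + D, fun s => (norm_add_le _ _).trans (add_le_add (hC s) (hD s))⟩
    | smul c p _ h =>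
      obtain ⟨C, hC⟩ := h
      refine ⟨‖c‖ * C, fun s => ?_⟩
      change ‖c • p.1 s‖ ≤ _
      rw [norm_smul]
      gcongr
      exact hC s
  inner_eq := by
    intro p hp x
    refine (?_ : Integrable p.1 (E.scalarMeasure x) ∧ _).2
    induction hp using Submodule.span_induction with
    | mem p hp =>
      obtain ⟨X, hX, rfl⟩ := hp
      refine ⟨((IsBddMeas.indicator_one hX).memLp _).integrable (by norm_num), ?_⟩
      have h1 : inner ℂ x (E.toFun X x) = ((inner ℂ x (E.toFun X x)).re : ℂ) := by
        refine (Complex.conj_eq_iff_re.1 ?_).symm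
        have h2 : ContinuousLinearMap.adjoint (E.toFun X) = E.toFun X :=
          (E.isStarProjection X hX).isSelfAdjoint
        rw [inner_conj_symm, ← ContinuousLinearMap.adjoint_inner_right, h2]
      simp only
      rw [h1, E.inner_self_eq hX, integral_indicator hX]
      simp only [Pi.one_apply]
      rw [setIntegral_const, Measure.real, E.scalarMeasure_apply x hX,
        ENNReal.toReal_ofReal (by positivity)]
      simp
    | zero => exact ⟨integrable_zero _ _ _, by simp⟩
    | add p q _ _ h1 h2 =>
      refine ⟨h1.1.add h2.1, ?_⟩
      change inner ℂ x (p.2 x + q.2 x) = ∫ s, p.1 s + q.1 s ∂_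
      rw [integral_add h1.1 h2.1, inner_add_right, h1.2, h2.2]
    | smul c p _ h =>
      refine ⟨h.1.smul c, ?_⟩
      change inner ℂ x (c • p.2 x) = ∫ s, c • p.1 s ∂_
      rw [integral_smul, inner_smul_right, h.2]; rfl
  dense := by
    intro ν _ g hg ε hε
    -- every simple function occurs in the algebra
    have key : ∀ u : SimpleFunc ℝ ℂ, ∃ T, ((u : ℝ → ℂ), T) ∈ Submodule.span ℂ
        {p | ∃ X, MeasurableSet X ∧ p = (X.indicator (1 : ℝ → ℂ), E.toFun X)} := by
      intro u
      induction u using SimpleFunc.induction with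
      | @const c X hX =>
        refine ⟨c • E.toFun X, ?_⟩
        have h1 := Submodule.smul_mem _ c (Submodule.subset_span (R := ℂ)
          (s := {p | ∃ X, MeasurableSet X ∧ p = (X.indicator (1 : ℝ → ℂ), E.toFun X)})
          ⟨X, hX, rfl⟩)
        convert h1 using 1
        refine Prod.ext ?_ rfl
        ext l
        by_cases h : l ∈ X <;> simp [h]
      | @add u v _ hu hv =>
        obtain ⟨T, hT⟩ := hu
        obtain ⟨T', hT'⟩ := hv
        exact ⟨T + T', add_mem hT hT'⟩
    obtain ⟨u, hu, -⟩ := hg.exists_simpleFunc_eLpNorm_sub_lt (by norm_num) hε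
    obtain ⟨T, hT⟩ := key u
    refine ⟨_, hT, ?_⟩
    rw [← eLpNorm_neg, neg_sub]
    exact hu.le

variable {E}

theorem I_indicator {X : Set ℝ} (hX : MeasurableSet X) (f : 𝓗) :
    E.borelCalculus.I f (X.indicator 1) = E.toFun X f :=
  BorelCalculus.I_alg (Φ := E.borelCalculus)
    ⟨(X.indicator 1, E.toFun X), Submodule.subset_span ⟨X, hX, rfl⟩⟩ f

theorem I_one (f : 𝓗) : E.borelCalculus.I f 1 = f := by
  have := I_indicator (E := E) MeasurableSet.univ f
  rw [Set.indicator_univ, E.univ] at this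
  exact this

theorem toFun_I {X : Set ℝ} (hX : MeasurableSet X) (f : 𝓗) {u : ℝ → ℂ}
    (hu : MemLp u 2 (E.scalarMeasure f)) :
    E.toFun X (E.borelCalculus.I f u) = E.borelCalculus.I f (X.indicator u) := by
  rw [← I_indicator hX, BorelCalculus.I_I f (IsBddMeas.indicator_one hX) hu]
  congr 1
  ext l
  by_cases h : l ∈ X <;> simp [h]

/-- Operators of the calculus commute with the spectral projections. -/
theorem toFun_I_comm {X : Set ℝ} (hX : MeasurableSet X) (f : 𝓗) {g : ℝ → ℂ} (hg : IsBddMeas g) :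
    E.toFun X (E.borelCalculus.I f g) = E.borelCalculus.I (E.toFun X f) g := by
  rw [toFun_I hX f (hg.memLp _), ← I_indicator hX,
    BorelCalculus.I_I f hg ((IsBddMeas.indicator_one hX).memLp _)]
  congr 1
  ext l
  by_cases h : l ∈ X <;> simp [h]

end ProjectionMeasure

namespace BorelCalculus

variable {S : Type*} [MeasurableSpace S] {Φ : BorelCalculus 𝓗 S}

/-- Dominated convergence for the functional calculus. -/
theorem tendsto_I_of_dominated {ι : Type*} {l : Filter ι} [l.IsCountablyGenerated] {x : 𝓗}
    {u : ι → S → ℂ} {g : S → ℂ} {b : S → ℂ} (hu : ∀ i, Measurable (u i)) (hg : Measurable g)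
    (hb : MemLp b 2 (Φ.μ x)) (hub : ∀ i s, ‖u i s‖ ≤ ‖b s‖) (hgb : ∀ s, ‖g s‖ ≤ ‖b s‖)
    (h : ∀ s, Tendsto (fun i => u i s) l (𝓝 (g s))) :
    Tendsto (fun i => Φ.I x (u i)) l (𝓝 (Φ.I x g)) := by
  have hu' : ∀ i, MemLp (u i) 2 (Φ.μ x) := fun i =>
    hb.mono (hu i).aestronglyMeasurable (Eventually.of_forall (hub i))
  have hg' : MemLp g 2 (Φ.μ x) := hb.mono hg.aestronglyMeasurable (Eventually.of_forall hgb)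
  refine tendsto_I hu' hg' ?_
  have h1 : Tendsto (fun i => ∫⁻ s, ‖(u i - g) s‖ₑ ^ 2 ∂(Φ.μ x)) l (𝓝 (∫⁻ _, 0 ∂(Φ.μ x))) := by
    refine tendsto_lintegral_filter_of_dominated_convergence (fun s => ‖(2 : ℂ) * b s‖ₑ ^ 2)
      (Eventually.of_forall fun i => ((hu i).sub hg).enorm.pow_const 2)
      (Eventually.of_forall fun i => Eventually.of_forall fun s => ?_) ?_
      (Eventually.of_forall fun s => ?_)
    · gcongr
      rw [enorm_le_iff_norm_le]
      calc ‖(u i - g) s‖ ≤ ‖u i s‖ + ‖g s‖ := norm_sub_le _ _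
        _ ≤ ‖b s‖ + ‖b s‖ := add_le_add (hub i s) (hgb s)
        _ = ‖(2 : ℂ) * b s‖ := by rw [norm_mul, Complex.norm_ofNat]; ring
    · rw [← eLpNorm_two_sq]
      exact ENNReal.pow_ne_top (hb.const_mul 2).2.ne
    · have h2 : Tendsto (fun i => ‖(u i - g) s‖ₑ ^ 2) l (𝓝 (‖g s - g s‖ₑ ^ 2)) := by
        have h3 : Tendsto (fun i => ‖u i s - g s‖ₑ) l (𝓝 ‖g s - g s‖ₑ) :=
          ((h s).sub_const (g s)).enorm
        exact ENNReal.Tendsto.pow h3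
      simpa using h2
  simp only [← eLpNorm_two_sq, lintegral_zero] at h1
  have h2 := h1.ennrpow_const (1 / 2 : ℝ)
  rw [ENNReal.zero_rpow_of_pos (by norm_num)] at h2
  refine h2.congr fun s => ?_
  rw [← ENNReal.rpow_natCast, ← ENNReal.rpow_mul]
  norm_num

end BorelCalculus

/-! ### Unitary groups -/

namespace IsUnitaryGroupOf

variable {H H' : 𝓗 →ₗ.[ℂ] 𝓗} {U U' : ℝ → 𝓗 →L[ℂ] 𝓗}

theorem norm_map (hU : IsUnitaryGroupOf H U) (t : ℝ) (f : 𝓗) : ‖U t f‖ = ‖f‖ :=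
  ContinuousLinearMap.norm_map_of_mem_unitary (hU.unitary t) f

theorem inner_map_map (hU : IsUnitaryGroupOf H U) (t : ℝ) (f g : 𝓗) :
    inner ℂ (U t f) (U t g) = inner ℂ f g :=
  ContinuousLinearMap.inner_map_map_of_mem_unitary (hU.unitary t) f g

theorem add_apply (hU : IsUnitaryGroupOf H U) (s t : ℝ) (f : 𝓗) : U (s + t) f = U s (U t f) := by
  rw [hU.add]; rfl

theorem zero_apply (hU : IsUnitaryGroupOf H U) (f : 𝓗) : U 0 f = f := by
  have h1 : U 0 (U 0 f - f) = 0 := by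
    rw [map_sub, ← hU.add_apply, add_zero, sub_self]
  have h2 := hU.norm_map 0 (U 0 f - f)
  rw [h1, norm_zero] at h2
  exact sub_eq_zero.1 (norm_eq_zero.1 h2.symm)

theorem apply_neg (hU : IsUnitaryGroupOf H U) (t : ℝ) (f : 𝓗) : U t (U (-t) f) = f := by
  rw [← hU.add_apply, add_neg_cancel, hU.zero_apply]

theorem apply_comm (hU : IsUnitaryGroupOf H U) (s t : ℝ) (f : 𝓗) :
    U s (U t f) = U t (U s f) := by
  rw [← hU.add_apply, ← hU.add_apply, add_comm]

theorem inner_neg_right (hU : IsUnitaryGroupOf H U) (t : ℝ) (f g : 𝓗) :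
    inner ℂ f (U (-t) g) = inner ℂ (U t f) g := by
  rw [← hU.inner_map_map t, hU.apply_neg]

theorem hasDerivAt (hU : IsUnitaryGroupOf H U) {f g : 𝓗} (h : (f, g) ∈ H.graph) (t : ℝ) :
    HasDerivAt (fun s => U s f) (-Complex.I • U t g) t := by
  have h1 := (hU.generator f g).2 h
  have h2 : HasDerivAt (fun s => U (s - t) f) (-Complex.I • g) t :=
    HasDerivAt.comp_sub_const t t (by rwa [sub_self])
  have h3 := ((U t).restrictScalars ℝ).hasFDerivAt.comp_hasDerivAt t h2
  simp only [ContinuousLinearMap.coe_restrictScalars', map_smul] at h3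
  refine h3.congr_of_eventuallyEq (Eventually.of_forall fun s => ?_)
  change U s f = U t (U (s - t) f)
  rw [← hU.add_apply, add_sub_cancel]

/-- A bounded operator that commutes with the group commutes with its generator. -/
theorem mem_graph_of_comm (hU : IsUnitaryGroupOf H U) {B : 𝓗 →L[ℂ] 𝓗}
    (hB : ∀ t f, B (U t f) = U t (B f)) {f g : 𝓗} (h : (f, g) ∈ H.graph) :
    (B f, B g) ∈ H.graph := by
  refine (hU.generator _ _).1 ?_
  have h1 := (B.restrictScalars ℝ).hasFDerivAt.comp_hasDerivAt 0 ((hU.generator f g).2 h)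
  simp only [ContinuousLinearMap.coe_restrictScalars', map_smul] at h1
  exact h1.congr_of_eventuallyEq (Eventually.of_forall fun s => (hB s f).symm)

theorem mem_graph (hU : IsUnitaryGroupOf H U) {f g : 𝓗} (h : (f, g) ∈ H.graph) (t : ℝ) :
    (U t f, U t g) ∈ H.graph :=
  hU.mem_graph_of_comm (fun s f => hU.apply_comm t s f) h

theorem hasDerivAt_inner (hU : IsUnitaryGroupOf H U) (hU' : IsUnitaryGroupOf H' U')
    {v w f g : 𝓗} (hv : (v, w) ∈ H.graph) (hf : (f, g) ∈ H'.graph) (t : ℝ) :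
    HasDerivAt (fun s => inner ℂ (U s v) (U' s f))
      (Complex.I * (inner ℂ (U t w) (U' t f) - inner ℂ (U t v) (U' t g))) t := by
  have h := (hU.hasDerivAt hv t).inner ℂ (hU'.hasDerivAt hf t)
  refine h.congr_deriv ?_
  rw [inner_smul_left, inner_smul_right]
  simp only [map_neg, Complex.conj_I, neg_neg]
  ring

/-- A unitary group is determined by its generator. -/
theorem apply_eq_of_generator (hU : IsUnitaryGroupOf H U) (hU' : IsUnitaryGroupOf H U')
    (hH : IsSelfAdjoint H) (t : ℝ) (f : 𝓗) : U' t f = U t f := by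
  -- the derivative of `(U(s) v, U'(s) f)` vanishes, because `H` is symmetric
  have key : ∀ v ∈ H.domain, ∀ f ∈ H.domain, inner ℂ (U t v) (U' t f) = inner ℂ v f := by
    intro v hv f hf
    have hd : ∀ s, HasDerivAt (fun s => inner ℂ (U s v) (U' s f)) 0 s := by
      intro s
      have h1 := hU.hasDerivAt_inner hU' (H.mem_graph ⟨v, hv⟩) (H.mem_graph ⟨f, hf⟩) s
      refine h1.congr_deriv ?_
      obtain ⟨v', hv1, hv2⟩ := (LinearPMap.mem_graph_iff H).1 (hU.mem_graph (H.mem_graph ⟨v, hv⟩) s)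
      obtain ⟨f', hf1, hf2⟩ := (LinearPMap.mem_graph_iff H).1 (hU'.mem_graph (H.mem_graph ⟨f, hf⟩) s)
      simp only at hv1 hv2 hf1 hf2
      rw [← hv1, ← hv2, ← hf1, ← hf2, inner_apply_left hH, sub_self, mul_zero]
    have h2 := is_const_of_deriv_eq_zero (fun s => (hd s).differentiableAt) (fun s => (hd s).deriv) t 0
    rwa [hU.zero_apply, hU'.zero_apply] at h2
  have h1 : ∀ f ∈ H.domain, U' t f = U t f := by
    intro f hf
    have h2 : U (-t) (U' t f) - f = 0 := by
      refine hH.dense_domain.eq_zero_of_inner_right ℂ fun v hv => ?_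
      rw [inner_sub_right, hU.inner_neg_right, key v hv f hf, sub_self]
    rw [← hU.apply_neg t (U' t f), sub_eq_zero.1 h2]
  exact congrFun (Continuous.ext_on hH.dense_domain (U' t).continuous (U t).continuous h1) f

end IsUnitaryGroupOf

/-- The function `λ ↦ e^{-itλ}`. -/
def phase (t l : ℝ) : ℂ := Complex.exp (Complex.I * ((-(t * l) : ℝ) : ℂ))

theorem norm_phase (t l : ℝ) : ‖phase t l‖ = 1 := by
  rw [phase, mul_comm, Complex.norm_exp_ofReal_mul_I]

theorem isBddMeas_phase (t : ℝ) : IsBddMeas (phase t) :=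
  ⟨by unfold phase; fun_prop, 1, fun l => (norm_phase t l).le⟩

theorem phase_add (s t : ℝ) : phase (s + t) = phase s * phase t := by
  ext l
  rw [Pi.mul_apply, phase, phase, phase, ← Complex.exp_add]
  congr 1
  push_cast
  ring

theorem star_phase (t : ℝ) : star (phase t) = phase (-t) := by
  ext l
  change (starRingEnd ℂ) (phase t l) = _
  rw [phase, phase, ← Complex.exp_conj]
  congr 1
  rw [map_mul, Complex.conj_I, Complex.conj_ofReal]
  push_cast
  ring

theorem phase_zero : phase 0 = 1 := by
  ext l
  simp [phase]

namespace ProjectionMeasure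

variable (E : ProjectionMeasure 𝓗) {H : 𝓗 →ₗ.[ℂ] 𝓗}

/-- The group `∫ e^{-itλ} dE(λ)`. -/
def group (t : ℝ) : 𝓗 →L[ℂ] 𝓗 := BorelCalculus.op I_one (Φ := E.borelCalculus) (isBddMeas_phase t)

theorem group_apply (t : ℝ) (f : 𝓗) : E.group t f = E.borelCalculus.I f (phase t) := rfl

theorem group_add (s t : ℝ) : E.group (s + t) = E.group s * E.group t := by
  ext f
  change _ = E.group s (E.group t f)
  simp only [group_apply]
  rw [phase_add, BorelCalculus.I_I f (isBddMeas_phase s) ((isBddMeas_phase t).memLp _)]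

theorem group_zero : E.group 0 = 1 := by
  ext f
  rw [group_apply, phase_zero, I_one]; rfl

theorem star_group (t : ℝ) : star (E.group t) = E.group (-t) := by
  refine ((ContinuousLinearMap.eq_adjoint_iff _ _).2 fun x y => ?_).symm
  simp only [group_apply]
  rw [BorelCalculus.inner_I_left y x (isBddMeas_phase t), star_phase]

theorem group_mem_unitary (t : ℝ) : E.group t ∈ unitary (𝓗 →L[ℂ] 𝓗) := by
  rw [Unitary.mem_iff, star_group, ← group_add, ← group_add, neg_add_cancel, add_neg_cancel,
    group_zero]
  exact ⟨rfl, rfl⟩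

theorem continuous_group (f : 𝓗) : Continuous fun t => E.group t f := by
  rw [continuous_iff_continuousAt]
  intro t
  refine BorelCalculus.tendsto_I_of_dominated (b := 1) (fun s => (isBddMeas_phase s).1)
    (isBddMeas_phase t).1 (BorelCalculus.isBddMeas_one.memLp _) (fun s l => by simp [norm_phase])
    (fun l => by simp [norm_phase]) (fun l => ?_)
  have : Continuous fun s => phase s l := by unfold phase; fun_prop
  exact this.continuousAt

variable {E}

theorem memLp_id (hE : E.IsSpectralMeasureOf H) (f : 𝓗) :
    MemLp (fun l : ℝ => (l : ℂ)) 2 (E.scalarMeasure f) ↔ f ∈ H.domain := by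
  have hm : AEStronglyMeasurable (fun l : ℝ => (l : ℂ)) (E.scalarMeasure f) :=
    Complex.measurable_ofReal.aestronglyMeasurable
  have h1 : eLpNorm (fun l : ℝ => (l : ℂ)) 2 (E.scalarMeasure f) ^ 2 =
      ∫⁻ l, ‖l‖ₑ ^ 2 ∂(E.scalarMeasure f) := by
    rw [BorelCalculus.eLpNorm_two_sq]
    refine lintegral_congr fun l => ?_
    rw [← ofReal_norm, ← ofReal_norm, Complex.norm_real]
  rw [hE.1 f, ← h1, MemLp, and_iff_right hm]
  constructor
  · exact fun h => ENNReal.pow_lt_top h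
  · intro h
    by_contra h'
    rw [not_lt, top_le_iff] at h'
    simp [h'] at h

/-- The group of the spectral measure is differentiable on the domain of the operator. -/
theorem hasDerivAt_group {f : 𝓗} (hf : MemLp (fun l : ℝ => (l : ℂ)) 2 (E.scalarMeasure f)) :
    HasDerivAt (fun t => E.group t f)
      (-Complex.I • E.borelCalculus.I f (fun l : ℝ => (l : ℂ))) 0 := by
  rw [hasDerivAt_iff_tendsto_slope]
  have h1L : MemLp (1 : ℝ → ℂ) 2 (E.scalarMeasure f) := BorelCalculus.isBddMeas_one.memLp _
  rw [← BorelCalculus.I_smul (Φ := E.borelCalculus) hf]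
  have hslope : ∀ t, slope (fun t => E.group t f) 0 t =
      E.borelCalculus.I f ((t : ℂ)⁻¹ • (phase t - 1)) := by
    intro t
    have hp : MemLp (phase t) 2 (E.scalarMeasure f) := (isBddMeas_phase t).memLp _
    rw [slope_def_module, sub_zero, BorelCalculus.I_smul (Φ := E.borelCalculus) (hp.sub h1L),
      BorelCalculus.I_sub (Φ := E.borelCalculus) hp h1L, I_one, group_zero, ← Complex.ofReal_inv,
      Complex.coe_smul]
    rfl
  rw [funext hslope]
  refine BorelCalculus.tendsto_I_of_dominated (b := fun l : ℝ => (l : ℂ)) (fun t => ?_) (by fun_prop)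
    hf (fun t l => ?_) (fun l => by simp) (fun l => ?_)
  · exact ((isBddMeas_phase t).1.sub measurable_one).const_smul _
  · simp only [Pi.smul_apply, Pi.sub_apply, Pi.one_apply, smul_eq_mul, norm_mul, norm_inv,
      Complex.norm_real]
    by_cases ht : t = 0
    · simp [ht]
    · have h1 : ‖phase t l - 1‖ ≤ ‖t‖ * ‖l‖ := by
        have := Real.norm_exp_I_mul_ofReal_sub_one_le (x := -(t * l))
        rwa [norm_neg, norm_mul] at this
      rw [inv_mul_le_iff₀ (norm_pos_iff.2 ht)]
      exact h1
  · have h1 : HasDerivAt (fun t => phase t l) (-Complex.I * l) 0 := by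
      have h2 : HasDerivAt (fun t : ℝ => Complex.I * ((-(t * l) : ℝ) : ℂ)) (-Complex.I * l) 0 := by
        have h3 : HasDerivAt (fun t : ℝ => -(t * l)) (-(1 * l)) 0 :=
          ((hasDerivAt_id (0 : ℝ)).mul_const l).neg
        have h4 := h3.ofReal_comp.const_mul Complex.I
        refine h4.congr_deriv ?_
        push_cast
        ring
      have h5 := h2.cexp
      refine h5.congr_deriv ?_
      simp
    rw [hasDerivAt_iff_tendsto_slope] at h1
    have h6 : (-Complex.I • fun l : ℝ => (l : ℂ)) l = -Complex.I * l := rfl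
    rw [h6]
    refine h1.congr fun t => ?_
    rw [slope_def_module, sub_zero, ← Complex.coe_smul, Complex.ofReal_inv, phase_zero]
    rfl

/-- On its domain the operator acts as multiplication by `λ`. Both sides have the same quadratic
form, so they agree by polarization. -/
theorem apply_eq_I (hH : IsSelfAdjoint H) (hE : E.IsSpectralMeasureOf H) (f : H.domain) :
    H f = E.borelCalculus.I (f : 𝓗) (fun l : ℝ => (l : ℂ)) := by
  have hL : ∀ f : H.domain, MemLp (fun l : ℝ => (l : ℂ)) 2 (E.scalarMeasure (f : 𝓗)) :=
    fun f => (memLp_id hE f).2 f.2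
  set A : H.domain → 𝓗 := fun f => E.borelCalculus.I (f : 𝓗) (fun l : ℝ => (l : ℂ)) with hA
  have hd : ∀ f : H.domain, HasDerivAt (fun t => E.group t f) (-Complex.I • A f) 0 :=
    fun f => hasDerivAt_group (hL f)
  have hI : -Complex.I ≠ 0 := neg_ne_zero.2 Complex.I_ne_zero
  have hadd : ∀ f g, A (f + g) = A f + A g := by
    intro f g
    have h1 := (hd f).add (hd g)
    rw [← smul_add] at h1
    refine smul_right_injective 𝓗 hI ((hd (f + g)).unique (h1.congr_of_eventuallyEq ?_))
    exact Eventually.of_forall fun t => by simp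
  have hsmul : ∀ (c : ℂ) f, A (c • f) = c • A f := by
    intro c f
    have h1 := (hd f).const_smul c
    rw [smul_comm] at h1
    refine smul_right_injective 𝓗 hI ((hd (c • f)).unique (h1.congr_of_eventuallyEq ?_))
    exact Eventually.of_forall fun t => by simp
  set B : H.domain → 𝓗 := fun f => A f - H f with hB
  have hBadd : ∀ f g, B (f + g) = B f + B g := fun f g => by
    simp only [hB, hadd, LinearPMap.map_add]; abel
  have hBsmul : ∀ (c : ℂ) f, B (c • f) = c • B f := fun c f => by
    simp only [hB, hsmul, LinearPMap.map_smul, smul_sub]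
  have hq : ∀ f : H.domain, inner ℂ (f : 𝓗) (B f) = 0 := by
    intro f
    have h1 : inner ℂ (f : 𝓗) (A f) = ((∫ l, l ∂(E.scalarMeasure (f : 𝓗)) : ℝ) : ℂ) := by
      conv_lhs => enter [2]; rw [← I_one (E := E) (f : 𝓗)]
      rw [hA]
      simp only
      rw [BorelCalculus.inner_I (Φ := E.borelCalculus) (BorelCalculus.isBddMeas_one.memLp _) (hL f)]
      simp only [Pi.one_apply, map_one, mul_one]
      exact integral_complex_ofReal
    rw [hB]
    simp only
    rw [inner_sub_right, h1, hE.2 f, sub_self]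
  have hpol : ∀ v w : H.domain, inner ℂ (v : 𝓗) (B w) = 0 := by
    intro v w
    have h1 := hq (v + w)
    have h2 := hq (v + Complex.I • w)
    simp only [hBadd, hBsmul, Submodule.coe_add, Submodule.coe_smul, inner_add_left,
      inner_add_right, inner_smul_left, inner_smul_right, hq, Complex.conj_I] at h1 h2
    have h3 : Complex.I * (inner ℂ (v : 𝓗) (B w) - inner ℂ (w : 𝓗) (B v)) = 0 := by
      rw [← h2]; ring
    have h4 := (mul_eq_zero.1 h3).resolve_left Complex.I_ne_zero
    have h5 : 2 * inner ℂ (v : 𝓗) (B w) = 0 := by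
      linear_combination h1 + h4
    simpa using h5
  have h0 : B f = 0 := hH.dense_domain.eq_zero_of_inner_right ℂ fun v hv => hpol ⟨v, hv⟩ f
  exact (sub_eq_zero.1 h0).symm

/-- Stone's theorem: `∫ e^{-itλ} dE(λ)` is the group generated by `-iH`. The generator is no larger
than `-iH`, because a self-adjoint operator is maximal. -/
theorem isUnitaryGroupOf_group (hH : IsSelfAdjoint H) (hE : E.IsSpectralMeasureOf H) :
    IsUnitaryGroupOf H E.group where
  unitary := E.group_mem_unitary
  add := E.group_add
  continuous := E.continuous_group
  generator := by
    have hdir : ∀ f : H.domain, HasDerivAt (fun t => E.group t f) (-Complex.I • H f) 0 := by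
      intro f
      rw [apply_eq_I hH hE f]
      exact hasDerivAt_group ((memLp_id hE f).2 f.2)
    intro f g
    constructor
    · intro h
      refine mem_graph_of_inner_eq hH fun v => ?_
      have h1 := (hdir v).inner ℂ h
      have h2 : ∀ t, inner ℂ (E.group t v) (E.group t f) = inner ℂ (v : 𝓗) f := fun t =>
        ContinuousLinearMap.inner_map_map_of_mem_unitary (E.group_mem_unitary t) _ _
      simp only [h2] at h1
      have h3 := h1.unique (hasDerivAt_const 0 _)
      rw [group_zero, inner_smul_left, inner_smul_right] at h3
      simp only [map_neg, Complex.conj_I, neg_neg, one_apply_eq_self] at h3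
      have h4 : Complex.I * (inner ℂ (H v) f - inner ℂ (v : 𝓗) g) = 0 := by
        rw [← h3]; ring
      exact sub_eq_zero.1 ((mul_eq_zero.1 h4).resolve_left Complex.I_ne_zero)
    · intro h
      obtain ⟨f', hf1, hf2⟩ := (LinearPMap.mem_graph_iff H).1 h
      simp only at hf1 hf2
      rw [← hf1, ← hf2]
      exact hdir f'

end ProjectionMeasure

/-! ### The spectral measure and the unitary group of a self-adjoint operator -/

section Evolution

variable {H : 𝓗 →ₗ.[ℂ] 𝓗}

theorem isSpectralMeasureOf_spectralMeasure (hH : IsSelfAdjoint H) :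
    (spectralMeasure H).IsSpectralMeasureOf H := by
  have h := exists_isSpectralMeasureOf hH
  rw [spectralMeasure, dif_pos h]
  exact h.choose_spec

theorem isUnitaryGroupOf_evolution (hH : IsSelfAdjoint H) :
    IsUnitaryGroupOf H (evolution H) := by
  have h : ∃ U, IsUnitaryGroupOf H U :=
    ⟨_, ProjectionMeasure.isUnitaryGroupOf_group hH (isSpectralMeasureOf_spectralMeasure hH)⟩
  rw [evolution, dif_pos h]
  exact h.choose_spec

theorem evolution_apply (hH : IsSelfAdjoint H) (t : ℝ) (f : 𝓗) :
    evolution H t f = (spectralMeasure H).borelCalculus.I f (phase t) :=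
  (ProjectionMeasure.isUnitaryGroupOf_group hH
    (isSpectralMeasureOf_spectralMeasure hH)).apply_eq_of_generator
    (isUnitaryGroupOf_evolution hH) hH t f

theorem toFun_evolution (hH : IsSelfAdjoint H) {X : Set ℝ} (hX : MeasurableSet X) (t : ℝ) (f : 𝓗) :
    (spectralMeasure H).toFun X (evolution H t f) =
      evolution H t ((spectralMeasure H).toFun X f) := by
  rw [evolution_apply hH, evolution_apply hH,
    ProjectionMeasure.toFun_I_comm hX f (isBddMeas_phase t)]

theorem toFun_mem_graph (hH : IsSelfAdjoint H) {X : Set ℝ} (hX : MeasurableSet X) {f g : 𝓗}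
    (h : (f, g) ∈ H.graph) :
    ((spectralMeasure H).toFun X f, (spectralMeasure H).toFun X g) ∈ H.graph :=
  (isUnitaryGroupOf_evolution hH).mem_graph_of_comm (fun t f => toFun_evolution hH hX t f) h

/-- The group determines the spectral measure through its Fourier transform. -/
theorem charFun_scalarMeasure (hH : IsSelfAdjoint H) (f : 𝓗) (t : ℝ) :
    charFun ((spectralMeasure H).scalarMeasure f) t = inner ℂ f (evolution H (-t) f) := by
  rw [evolution_apply hH, charFun_apply_real]
  conv_rhs => enter [2]; rw [← ProjectionMeasure.I_one (E := spectralMeasure H) f]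
  rw [BorelCalculus.inner_I (Φ := (spectralMeasure H).borelCalculus)
    (BorelCalculus.isBddMeas_one.memLp _) ((isBddMeas_phase _).memLp _)]
  refine integral_congr_ae (Eventually.of_forall fun l => ?_)
  simp only [phase, Pi.one_apply, map_one, mul_one]
  congr 1
  push_cast
  ring

theorem toFun_toFun (E : ProjectionMeasure 𝓗) {X : Set ℝ} (hX : MeasurableSet X) (f : 𝓗) :
    E.toFun X (E.toFun X f) = E.toFun X f := by
  rw [E.toFun_apply_toFun hX hX, Set.inter_self]

theorem toFun_eq_of_subset (E : ProjectionMeasure 𝓗) {X Y : Set ℝ} (hX : MeasurableSet X)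
    (hY : MeasurableSet Y) (hXY : X ⊆ Y) {f : 𝓗} (hf : E.toFun X f = f) : E.toFun Y f = f := by
  rw [← hf, E.toFun_apply_toFun hY hX, Set.inter_eq_self_of_subset_right hXY]

theorem norm_toFun_le (E : ProjectionMeasure 𝓗) {X : Set ℝ} (hX : MeasurableSet X) (f : 𝓗) :
    ‖E.toFun X f‖ ≤ ‖f‖ := by
  rw [← ProjectionMeasure.I_indicator hX]
  refine (BorelCalculus.norm_I_le (Φ := E.borelCalculus) (IsBddMeas.indicator_one hX) zero_le_one
    (fun l => ?_) (ProjectionMeasure.I_one f)).trans_eq (one_mul _)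
  by_cases h : l ∈ X <;> simp [h]

theorem toFun_add_toFun_compl (E : ProjectionMeasure 𝓗) {X : Set ℝ} (hX : MeasurableSet X)
    (f : 𝓗) : E.toFun X f + E.toFun Xᶜ f = f := by
  rw [← E.toFun_union hX hX.compl disjoint_compl_right, Set.union_compl_self, E.univ]
  rfl

theorem inner_toFun_left (E : ProjectionMeasure 𝓗) {X : Set ℝ} (hX : MeasurableSet X) (f g : 𝓗) :
    inner ℂ (E.toFun X f) g = inner ℂ f (E.toFun X g) := by
  have h2 : ContinuousLinearMap.adjoint (E.toFun X) = E.toFun X :=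
    (E.isStarProjection X hX).isSelfAdjoint
  rw [← ContinuousLinearMap.adjoint_inner_right, h2]

theorem ae_mem_of_toFun_eq {E : ProjectionMeasure 𝓗} {X : Set ℝ} (hX : MeasurableSet X) {f : 𝓗}
    (hf : E.toFun X f = f) : ∀ᵐ l ∂(E.scalarMeasure f), l ∈ X := by
  rw [ae_iff]
  change E.scalarMeasure f Xᶜ = 0
  rw [E.scalarMeasure_apply_eq_zero f hX.compl, ← hf,
    E.toFun_apply_of_disjoint hX.compl hX disjoint_compl_left]

theorem enorm_apply_sub_sq (hH : IsSelfAdjoint H) (a : ℝ) (f : H.domain) :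
    ‖H f - (a : ℂ) • (f : 𝓗)‖ₑ ^ 2 =
      ∫⁻ l, ‖l - a‖ₑ ^ 2 ∂((spectralMeasure H).scalarMeasure (f : 𝓗)) := by
  have hE := isSpectralMeasureOf_spectralMeasure hH
  have hL := (ProjectionMeasure.memLp_id hE f).2 f.2
  have h1L : MemLp (1 : ℝ → ℂ) 2 ((spectralMeasure H).scalarMeasure (f : 𝓗)) :=
    BorelCalculus.isBddMeas_one.memLp _
  have h1 : H f - (a : ℂ) • (f : 𝓗) = (spectralMeasure H).borelCalculus.I (f : 𝓗)
      ((fun l : ℝ => (l : ℂ)) - (a : ℂ) • (1 : ℝ → ℂ)) := by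
    rw [BorelCalculus.I_sub (Φ := (spectralMeasure H).borelCalculus) hL (h1L.const_smul _),
      BorelCalculus.I_smul (Φ := (spectralMeasure H).borelCalculus) h1L, ProjectionMeasure.I_one,
      ProjectionMeasure.apply_eq_I hH hE]
  rw [h1, BorelCalculus.enorm_I_sq (Φ := (spectralMeasure H).borelCalculus)
    (hL.sub (h1L.const_smul _))]
  refine lintegral_congr fun l => ?_
  rw [← ofReal_norm, ← ofReal_norm, ← Complex.norm_real]
  simp

theorem enorm_sq_eq_scalarMeasure_univ (E : ProjectionMeasure 𝓗) (f : 𝓗) :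
    E.scalarMeasure f Set.univ = ‖f‖ₑ ^ 2 := by
  rw [E.scalarMeasure_univ, ENNReal.ofReal_pow (norm_nonneg _), ofReal_norm]

theorem mem_domain_of_toFun_eq (hH : IsSelfAdjoint H) {X : Set ℝ} (hX : MeasurableSet X)
    (hb : Bornology.IsBounded X) {f : 𝓗} (hf : (spectralMeasure H).toFun X f = f) :
    f ∈ H.domain := by
  obtain ⟨C, hC⟩ := hb.exists_norm_le
  rw [(isSpectralMeasureOf_spectralMeasure hH).1 f]
  refine lt_of_le_of_lt (lintegral_mono_ae (g := fun _ => ENNReal.ofReal C ^ 2) ?_) ?_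
  · filter_upwards [ae_mem_of_toFun_eq hX hf] with l hl
    gcongr
    rw [← ofReal_norm]
    exact ENNReal.ofReal_le_ofReal (hC l hl)
  · rw [lintegral_const]
    exact ENNReal.mul_lt_top (ENNReal.pow_lt_top ENNReal.ofReal_lt_top) (measure_lt_top _ _)

theorem norm_apply_sub_le (hH : IsSelfAdjoint H) {X : Set ℝ} (hX : MeasurableSet X) {a δ : ℝ}
    (hδ : 0 ≤ δ) (h : ∀ l ∈ X, |l - a| ≤ δ) (f : H.domain)
    (hf : (spectralMeasure H).toFun X f = f) :
    ‖H f - (a : ℂ) • (f : 𝓗)‖ ≤ δ * ‖(f : 𝓗)‖ := by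
  have h1 : ‖H f - (a : ℂ) • (f : 𝓗)‖ₑ ^ 2 ≤ (ENNReal.ofReal δ * ‖(f : 𝓗)‖ₑ) ^ 2 := by
    rw [enorm_apply_sub_sq hH, mul_pow, ← enorm_sq_eq_scalarMeasure_univ (spectralMeasure H),
      ← lintegral_const]
    refine lintegral_mono_ae ?_
    filter_upwards [ae_mem_of_toFun_eq hX hf] with l hl
    gcongr
    rw [← ofReal_norm]
    exact ENNReal.ofReal_le_ofReal (h l hl)
  have h2 := (ENNReal.pow_right_strictMono (n := 2) (by norm_num)).le_iff_le.1 h1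
  rw [← ofReal_norm, ← ofReal_norm, ← ENNReal.ofReal_mul hδ] at h2
  exact (ENNReal.ofReal_le_ofReal_iff (by positivity)).1 h2

theorem le_norm_apply_sub (hH : IsSelfAdjoint H) {X : Set ℝ} (hX : MeasurableSet X) {a δ : ℝ}
    (hδ : 0 ≤ δ) (h : ∀ l ∈ X, δ ≤ |l - a|) (f : H.domain)
    (hf : (spectralMeasure H).toFun X f = f) :
    δ * ‖(f : 𝓗)‖ ≤ ‖H f - (a : ℂ) • (f : 𝓗)‖ := by
  have h1 : (ENNReal.ofReal δ * ‖(f : 𝓗)‖ₑ) ^ 2 ≤ ‖H f - (a : ℂ) • (f : 𝓗)‖ₑ ^ 2 := by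
    rw [enorm_apply_sub_sq hH, mul_pow, ← enorm_sq_eq_scalarMeasure_univ (spectralMeasure H),
      ← lintegral_const]
    refine lintegral_mono_ae ?_
    filter_upwards [ae_mem_of_toFun_eq hX hf] with l hl
    gcongr
    rw [← ofReal_norm]
    exact ENNReal.ofReal_le_ofReal (h l hl)
  have h2 := (ENNReal.pow_right_strictMono (n := 2) (by norm_num)).le_iff_le.1 h1
  rw [← ofReal_norm, ← ofReal_norm, ← ENNReal.ofReal_mul hδ] at h2
  exact (ENNReal.ofReal_le_ofReal_iff (by positivity)).1 h2

end Evolution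

/-! ### Square integrable trajectories -/

section Smooth

omit [CompleteSpace 𝓗] in
theorem pmapNorm_of_mem {G : 𝓗 →ₗ.[ℂ] 𝓖} {f : 𝓗} (h : f ∈ G.domain) :
    pmapNorm G f = ‖G ⟨f, h⟩‖ₑ := dif_pos h

omit [CompleteSpace 𝓗] in
theorem pmapNorm_compBounded (G : 𝓗 →ₗ.[ℂ] 𝓖) (B : 𝓗 →L[ℂ] 𝓗) (f : 𝓗) :
    pmapNorm (compBounded G B) f = pmapNorm G (B f) := rfl

variable {H : 𝓗 →ₗ.[ℂ] 𝓗} {G : 𝓗 →ₗ.[ℂ] 𝓖}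

omit [CompleteSpace 𝓗] in
theorem IsRelBounded.exists_pmapNorm_le (hG : IsRelBounded G H) :
    ∃ C : ℝ, 0 ≤ C ∧ ∀ f : H.domain,
      pmapNorm G f ≤ ENNReal.ofReal (C * ‖H f + Complex.I • (f : 𝓗)‖) := by
  obtain ⟨hd, C, hC⟩ := hG
  refine ⟨max C 0, le_max_right _ _, fun f => ?_⟩
  rw [pmapNorm_of_mem (hd f.2), ← ofReal_norm]
  refine ENNReal.ofReal_le_ofReal ((hC f).trans ?_)
  gcongr
  exact le_max_left _ _

/-- For `f` in the domain of `H`, the trajectory `t ↦ G e^{-iHt} f` is uniformly continuous. -/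
theorem IsRelBounded.exists_trajectory (hH : IsSelfAdjoint H) (hG : IsRelBounded G H)
    {f : 𝓗} (hf : f ∈ H.domain) : ∃ c : ℝ → 𝓖, UniformContinuous c ∧
      ∀ t, pmapNorm G (evolution H t f) = ‖c t‖ₑ := by
  have hU := isUnitaryGroupOf_evolution hH
  obtain ⟨hd, C, hC⟩ := hG
  have hmem : ∀ t, ∃ v : H.domain, (v : 𝓗) = evolution H t f ∧ H v = evolution H t (H ⟨f, hf⟩) :=
    fun t => (LinearPMap.mem_graph_iff H).1 (hU.mem_graph (H.mem_graph ⟨f, hf⟩) t)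
  choose v hv1 hv2 using hmem
  set y := H ⟨f, hf⟩ + Complex.I • f with hy
  refine ⟨fun t => G ⟨v t, hd (v t).2⟩, ?_, fun t => ?_⟩
  · have hdiff : ∀ s t, ‖G ⟨v s, hd (v s).2⟩ - G ⟨v t, hd (v t).2⟩‖ ≤
        |C| * ‖evolution H (s - t) y - y‖ := by
      intro s t
      have h1 := hC (v s - v t)
      have h2 : G ⟨(v s - v t : H.domain), hd (v s - v t).2⟩ =
          G ⟨v s, hd (v s).2⟩ - G ⟨v t, hd (v t).2⟩ := by
        rw [← LinearPMap.map_sub]; rfl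
      have h3 : H (v s - v t) + Complex.I • ((v s - v t : H.domain) : 𝓗) =
          evolution H t (evolution H (s - t) y - y) := by
        rw [map_sub, ← hU.add_apply, add_sub_cancel, hy, map_add, map_add, map_smul, map_smul,
          ← hv1, ← hv1, ← hv2, ← hv2, LinearPMap.map_sub, Submodule.coe_sub, smul_sub]
        abel
      rw [h2, h3, hU.norm_map] at h1
      refine h1.trans ?_
      gcongr
      exact le_abs_self C
    rw [Metric.uniformContinuous_iff]
    intro ε hε
    have hc : Tendsto (fun r => |C| * ‖evolution H r y - y‖) (𝓝 0) (𝓝 0) := by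
      have h4 : Continuous fun r => |C| * ‖evolution H r y - y‖ :=
        continuous_const.mul ((hU.continuous y).sub continuous_const).norm
      have h5 := h4.tendsto 0
      simpa [hU.zero_apply] using h5
    obtain ⟨η, hη, hη'⟩ := Metric.eventually_nhds_iff.1 (hc.eventually (gt_mem_nhds hε))
    refine ⟨η, hη, fun {s t} hst => ?_⟩
    rw [dist_eq_norm]
    refine (hdiff s t).trans_lt (hη' ?_)
    rwa [Real.dist_eq, sub_zero, ← Real.dist_eq]
  · rw [← hv1]
    exact pmapNorm_of_mem _

/-- A uniformly continuous square integrable function on the line vanishes at infinity. -/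
theorem tendsto_zero_of_uniformContinuous {F : Type*} [NormedAddCommGroup F] {c : ℝ → F}
    (hc : UniformContinuous c) (hint : ∫⁻ t, ‖c t‖ₑ ^ 2 ≠ ⊤) {l : Filter ℝ}
    [l.IsCountablyGenerated] (hl : l ≤ cocompact ℝ) : Tendsto c l (𝓝 0) := by
  rw [Metric.tendsto_nhds]
  intro ε hε
  obtain ⟨δ, hδ, hδ'⟩ := Metric.uniformContinuous_iff.1 hc (ε / 2) (by positivity)
  -- the integral over the window `[t, t + δ/2]` tends to zero, and it is not small if `c t` is not
  have hwin : Tendsto (fun t => ∫⁻ s, (Set.Icc t (t + δ / 2)).indicator (fun s => ‖c s‖ₑ ^ 2) s)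
      l (𝓝 (∫⁻ _ : ℝ, 0)) := by
    refine tendsto_lintegral_filter_of_dominated_convergence (fun s => ‖c s‖ₑ ^ 2)
      (Eventually.of_forall fun t => ?_)
      (Eventually.of_forall fun t => Eventually.of_forall fun s => Set.indicator_le_self _ _ s)
      hint (Eventually.of_forall fun s => ?_)
    · exact (hc.continuous.enorm.measurable.pow_const 2).indicator measurableSet_Icc
    · have h1 : (Set.Icc (s - δ / 2) s)ᶜ ∈ l := hl (isCompact_Icc.compl_mem_cocompact)
      refine tendsto_const_nhds.congr' ?_
      filter_upwards [h1] with t ht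
      rw [Set.indicator_of_notMem]
      intro h
      exact ht ⟨by linarith [h.2], h.1⟩
  rw [lintegral_zero] at hwin
  have hpos : (0 : ENNReal) < ENNReal.ofReal (ε / 2) ^ 2 * ENNReal.ofReal (δ / 2) := by
    have h1 : ENNReal.ofReal (ε / 2) ≠ 0 := by simpa using hε
    have h2 : ENNReal.ofReal (δ / 2) ≠ 0 := by simpa using hδ
    exact pos_iff_ne_zero.2 (mul_ne_zero (pow_ne_zero 2 h1) h2)
  filter_upwards [hwin.eventually (gt_mem_nhds hpos)] with t ht
  rw [dist_zero_right]
  by_contra hct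
  rw [not_lt] at hct
  refine absurd ht (not_lt.2 ?_)
  calc ENNReal.ofReal (ε / 2) ^ 2 * ENNReal.ofReal (δ / 2)
      = ∫⁻ _ in Set.Icc t (t + δ / 2), ENNReal.ofReal (ε / 2) ^ 2 := by
        rw [setLIntegral_const, Real.volume_Icc, add_sub_cancel_left]
    _ ≤ ∫⁻ s in Set.Icc t (t + δ / 2), ‖c s‖ₑ ^ 2 := by
        refine setLIntegral_mono' measurableSet_Icc fun s hs => ?_
        gcongr
        rw [← ofReal_norm]
        refine ENNReal.ofReal_le_ofReal ?_
        have h1 : dist t s < δ := by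
          rw [Real.dist_eq, abs_lt]
          constructor <;> linarith [hs.1, hs.2]
        have h2 := hδ' h1
        rw [dist_eq_norm] at h2
        have h3 := norm_sub_norm_le (c t) (c s)
        linarith
    _ = _ := (lintegral_indicator measurableSet_Icc _).symm

end Smooth

/-! ### Cook's method -/

section Wave

variable {H H₀ : 𝓗 →ₗ.[ℂ] 𝓗} {G G₀ : 𝓗 →ₗ.[ℂ] 𝓖}

/-- The bound on the form of `H - H₀` that a factorization `G* G₀` provides. It is symmetric in the
two pairs of operators. -/
def FormBound (H H₀ : 𝓗 →ₗ.[ℂ] 𝓗) (G G₀ : 𝓗 →ₗ.[ℂ] 𝓖) : Prop :=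
  ∀ (f : H.domain) (f₀ : H₀.domain),
    ‖inner ℂ (H f) (f₀ : 𝓗) - inner ℂ (f : 𝓗) (H₀ f₀)‖ₑ ≤ pmapNorm G f * pmapNorm G₀ f₀

omit [CompleteSpace 𝓗] in
theorem DifferenceFactors.formBound (h : DifferenceFactors H H₀ G G₀) : FormBound H H₀ G G₀ := by
  obtain ⟨hd, hd₀, h⟩ := h
  intro f f₀
  rw [h, pmapNorm_of_mem (hd f.2), pmapNorm_of_mem (hd₀ f₀.2), ← ofReal_norm, ← ofReal_norm,
    ← ofReal_norm, ← ENNReal.ofReal_mul (norm_nonneg _)]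
  exact ENNReal.ofReal_le_ofReal (norm_inner_le_norm _ _)

omit [CompleteSpace 𝓗] in
theorem FormBound.symm (h : FormBound H H₀ G G₀) : FormBound H₀ H G₀ G := by
  intro f₀ f
  have h1 := h f f₀
  rw [mul_comm, ← inner_conj_symm (H f), ← inner_conj_symm (f : 𝓗), ← map_sub, ← ofReal_norm,
    RCLike.norm_conj, norm_sub_rev, ofReal_norm] at h1
  exact h1

/-- Cook's method: the matrix elements of `e^{iHt} e^{-iH₀t}` vary by at most the product of the
`L²` norms of the two trajectories. -/
theorem FormBound.enorm_inner_sub_le (hV : FormBound H H₀ G G₀) (hH : IsSelfAdjoint H)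
    (hH₀ : IsSelfAdjoint H₀) (hG : IsRelBounded G H) (hG₀ : IsRelBounded G₀ H₀) {v f : 𝓗}
    (hv : v ∈ H.domain) (hf : f ∈ H₀.domain) (s t : ℝ) :
    ‖inner ℂ (evolution H t v) (evolution H₀ t f) -
      inner ℂ (evolution H s v) (evolution H₀ s f)‖ₑ ≤
    (∫⁻ r, pmapNorm G (evolution H r v) ^ 2) ^ (1 / 2 : ℝ) *
      (∫⁻ r in Set.uIoc s t, pmapNorm G₀ (evolution H₀ r f) ^ 2) ^ (1 / 2 : ℝ) := by
  have hU := isUnitaryGroupOf_evolution hH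
  have hU₀ := isUnitaryGroupOf_evolution hH₀
  obtain ⟨c, hc, hcn⟩ := hG.exists_trajectory hH hv
  obtain ⟨c₀, hc₀, hcn₀⟩ := hG₀.exists_trajectory hH₀ hf
  set φ' : ℝ → ℂ := fun r => Complex.I * (inner ℂ (evolution H r (H ⟨v, hv⟩)) (evolution H₀ r f) -
    inner ℂ (evolution H r v) (evolution H₀ r (H₀ ⟨f, hf⟩))) with hφ'
  have hder : ∀ r, HasDerivAt (fun r => inner ℂ (evolution H r v) (evolution H₀ r f)) (φ' r) r :=
    fun r => hU.hasDerivAt_inner hU₀ (H.mem_graph ⟨v, hv⟩) (H₀.mem_graph ⟨f, hf⟩) r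
  have hcont : Continuous φ' := continuous_const.mul
    (((hU.continuous _).inner (hU₀.continuous _)).sub ((hU.continuous _).inner (hU₀.continuous _)))
  have hbound : ∀ r, ‖φ' r‖ₑ ≤ ‖c r‖ₑ * ‖c₀ r‖ₑ := by
    intro r
    obtain ⟨v', hv1, hv2⟩ := (LinearPMap.mem_graph_iff H).1 (hU.mem_graph (H.mem_graph ⟨v, hv⟩) r)
    obtain ⟨f', hf1, hf2⟩ := (LinearPMap.mem_graph_iff H₀).1
      (hU₀.mem_graph (H₀.mem_graph ⟨f, hf⟩) r)
    simp only at hv1 hv2 hf1 hf2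
    rw [hφ']
    simp only
    rw [enorm_mul, ← hcn, ← hcn₀, ← hv1, ← hv2, ← hf1, ← hf2]
    have : ‖Complex.I‖ₑ = 1 := by rw [← ofReal_norm, Complex.norm_I, ENNReal.ofReal_one]
    rw [this, one_mul]
    exact hV v' f'
  rw [← intervalIntegral.integral_eq_sub_of_hasDerivAt (fun r _ => hder r)
    (hcont.intervalIntegrable _ _)]
  simp only [hcn, hcn₀]
  calc ‖∫ r in s..t, φ' r‖ₑ ≤ ∫⁻ r in Set.uIoc s t, ‖φ' r‖ₑ := by
        rw [← ofReal_norm, intervalIntegral.norm_intervalIntegral_eq, ofReal_norm]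
        exact enorm_integral_le_lintegral_enorm _
    _ ≤ ∫⁻ r in Set.uIoc s t, ((fun r => ‖c r‖ₑ) * fun r => ‖c₀ r‖ₑ) r :=
        lintegral_mono fun r => hbound r
    _ ≤ (∫⁻ r in Set.uIoc s t, ‖c r‖ₑ ^ (2 : ℝ)) ^ (1 / 2 : ℝ) *
        (∫⁻ r in Set.uIoc s t, ‖c₀ r‖ₑ ^ (2 : ℝ)) ^ (1 / 2 : ℝ) :=
        ENNReal.lintegral_mul_le_Lp_mul_Lq _ Real.HolderConjugate.two_two
          hc.continuous.enorm.measurable.aemeasurable hc₀.continuous.enorm.measurable.aemeasurable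
    _ ≤ _ := by
        simp only [ENNReal.rpow_ofNat]
        gcongr
        exact Measure.restrict_le_self

/-- Control of a convergent scalar function gives convergence. -/
theorem exists_tendsto_of_sq_norm_sub_le {F : Type*} [NormedAddCommGroup F] [CompleteSpace F]
    {ι : Type*} {l : Filter ι} [l.NeBot] {g : ι → F}
    {Ψ : ι → ℝ} {L C : ℝ} (hΨ : Tendsto Ψ l (𝓝 L))
    (h : ∀ s t, ‖g t - g s‖ ^ 2 ≤ C * |Ψ t - Ψ s|) : ∃ x, Tendsto g l (𝓝 x) := by
  rw [← cauchy_map_iff_exists_tendsto, Metric.cauchy_iff]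
  refine ⟨inferInstance, fun ε hε => ?_⟩
  have hC : 0 < |C| + 1 := by positivity
  have hη : 0 < ε ^ 2 / (2 * (|C| + 1)) := by positivity
  refine ⟨_, image_mem_map (Metric.tendsto_nhds.1 hΨ _ hη), ?_⟩
  rintro _ ⟨s, hs, rfl⟩ _ ⟨t, ht, rfl⟩
  simp only [Set.mem_ofPred_eq] at hs ht
  have h1 : |Ψ s - Ψ t| < 2 * (ε ^ 2 / (2 * (|C| + 1))) := by
    rw [← Real.dist_eq]
    have := dist_triangle_right (Ψ s) (Ψ t) L
    linarith
  have h2 : ‖g s - g t‖ ^ 2 < ε ^ 2 := by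
    calc ‖g s - g t‖ ^ 2 ≤ C * |Ψ s - Ψ t| := h t s
      _ ≤ (|C| + 1) * |Ψ s - Ψ t| := by
          gcongr
          linarith [le_abs_self C]
      _ < (|C| + 1) * (2 * (ε ^ 2 / (2 * (|C| + 1)))) := by gcongr
      _ = ε ^ 2 := by field_simp
  rw [dist_eq_norm]
  exact lt_of_pow_lt_pow_left₀ 2 hε.le h2

theorem exists_tendsto_intervalIntegral {F : ℝ → ℝ} (hF : Integrable F) {l : Filter ℝ}
    (hl : l = atTop ∨ l = atBot) : ∃ L, Tendsto (fun t => ∫ r in (0 : ℝ)..t, F r) l (𝓝 L) := by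
  rcases hl with rfl | rfl
  · exact ⟨_, intervalIntegral_tendsto_integral_Ioi 0 hF.integrableOn tendsto_id⟩
  · have h := (intervalIntegral_tendsto_integral_Iic 0 hF.integrableOn tendsto_id).neg
    refine ⟨_, h.congr fun t => ?_⟩
    rw [intervalIntegral.integral_symm]
    simp

/-- The trajectory bound of a smooth operator `G E(X)` for vectors in the range of `E(X)`. -/
theorem IsSmooth.exists_lintegral_le {X : Set ℝ} (hX : MeasurableSet X) (hH : IsSelfAdjoint H)
    (hs : IsSmooth (compBounded G ((spectralMeasure H).toFun X)) H) : ∃ C : ℝ, 0 ≤ C ∧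
      ∀ f ∈ H.domain, ∫⁻ t, pmapNorm G (evolution H t ((spectralMeasure H).toFun X f)) ^ 2 ≤
        ENNReal.ofReal (C * ‖f‖) ^ 2 := by
  obtain ⟨-, C, hC⟩ := hs
  refine ⟨|C|, abs_nonneg C, fun f hf => ?_⟩
  rw [← ENNReal.ofReal_pow (by positivity), mul_pow, sq_abs]
  refine le_trans (le_of_eq (lintegral_congr fun t => ?_)) (hC f hf)
  rw [pmapNorm_compBounded, toFun_evolution hH hX]

/-- If `G₀ E₀(X)` and `G E(Y)` are smooth, then `E(Y) e^{iHt} e^{-iH₀t}` converges strongly on the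
range of `E₀(X)`. -/
theorem FormBound.exists_tendsto_toFun (hV : FormBound H H₀ G G₀) (hH : IsSelfAdjoint H)
    (hH₀ : IsSelfAdjoint H₀) (hG : IsRelBounded G H) (hG₀ : IsRelBounded G₀ H₀) {X Y : Set ℝ}
    (hX : MeasurableSet X) (hY : MeasurableSet Y)
    (hsX : IsSmooth (compBounded G₀ ((spectralMeasure H₀).toFun X)) H₀)
    (hsY : IsSmooth (compBounded G ((spectralMeasure H).toFun Y)) H)
    {l : Filter ℝ} (hl : l = atTop ∨ l = atBot) {f : 𝓗} (hf : f ∈ H₀.domain)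
    (hfX : (spectralMeasure H₀).toFun X f = f) :
    ∃ g, Tendsto (fun t => (spectralMeasure H).toFun Y (evolution H (-t) (evolution H₀ t f)))
      l (𝓝 g) := by
  have hU := isUnitaryGroupOf_evolution hH
  have hlne : l.NeBot := by rcases hl with rfl | rfl <;> infer_instance
  obtain ⟨C, hC0, hC⟩ := hsY.exists_lintegral_le hY hH
  obtain ⟨C₀, -, hC₀⟩ := hsX.exists_lintegral_le hX hH₀
  obtain ⟨c₀, hc₀, hcn₀⟩ := hG₀.exists_trajectory hH₀ hf
  have hfin : ∫⁻ t, ‖c₀ t‖ₑ ^ 2 < ⊤ := by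
    have h1 := hC₀ f hf
    rw [hfX] at h1
    simp only [hcn₀] at h1
    exact lt_of_le_of_lt h1 (ENNReal.pow_lt_top ENNReal.ofReal_lt_top)
  have hF : Integrable (fun t => ‖c₀ t‖ ^ 2) := by
    refine ⟨(hc₀.continuous.norm.pow 2).aestronglyMeasurable, ?_⟩
    rw [hasFiniteIntegral_iff_enorm]
    refine lt_of_eq_of_lt (lintegral_congr fun t => ?_) hfin
    rw [enorm_pow, enorm_norm]
  obtain ⟨L, hL⟩ := exists_tendsto_intervalIntegral hF hl
  refine exists_tendsto_of_sq_norm_sub_le (C := C ^ 2) hL fun s t => ?_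
  rw [intervalIntegral.integral_interval_sub_left hF.intervalIntegrable hF.intervalIntegrable]
  set K := |∫ r in s..t, ‖c₀ r‖ ^ 2| with hK
  have hKint : ∫⁻ r in Set.uIoc s t, pmapNorm G₀ (evolution H₀ r f) ^ 2 = ENNReal.ofReal K := by
    simp only [hcn₀]
    rw [hK, intervalIntegral.abs_integral_eq_abs_integral_uIoc, abs_of_nonneg (by positivity),
      ofReal_integral_eq_lintegral_ofReal hF.integrableOn
        (Eventually.of_forall fun r => by positivity)]
    refine lintegral_congr fun r => ?_
    rw [ENNReal.ofReal_pow (norm_nonneg _), ofReal_norm]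
  set w : ℝ → 𝓗 := fun t => evolution H (-t) (evolution H₀ t f) with hw
  set h := (spectralMeasure H).toFun Y (w t) - (spectralMeasure H).toFun Y (w s) with hh
  have hinner : ∀ v ∈ H.domain, ‖inner ℂ v h‖ ≤ C * ‖v‖ * √K := by
    intro v hv
    have hmem := toFun_mem_graph hH hY (H.mem_graph ⟨v, hv⟩)
    obtain ⟨v', hv1, -⟩ := (LinearPMap.mem_graph_iff H).1 hmem
    have h1 := hV.enorm_inner_sub_le hH hH₀ hG hG₀ (v := (spectralMeasure H).toFun Y v)
      (by simp only at hv1; exact hv1 ▸ v'.2) hf s t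
    have h2 : inner ℂ v h = inner ℂ (evolution H t ((spectralMeasure H).toFun Y v))
        (evolution H₀ t f) - inner ℂ (evolution H s ((spectralMeasure H).toFun Y v))
        (evolution H₀ s f) := by
      rw [hh, inner_sub_right, ← inner_toFun_left _ hY, ← inner_toFun_left _ hY,
        hU.inner_neg_right, hU.inner_neg_right]
    rw [← h2, hKint] at h1
    have h3 : (∫⁻ r, pmapNorm G (evolution H r ((spectralMeasure H).toFun Y v)) ^ 2) ^ (1 / 2 : ℝ) ≤
        ENNReal.ofReal (C * ‖v‖) := by
      refine (ENNReal.rpow_le_rpow (hC v hv) (by norm_num)).trans_eq ?_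
      rw [← ENNReal.rpow_natCast, ← ENNReal.rpow_mul]
      norm_num
    have h4 : ENNReal.ofReal K ^ (1 / 2 : ℝ) = ENNReal.ofReal (√K) := by
      rw [ENNReal.ofReal_rpow_of_nonneg (abs_nonneg _) (by norm_num), Real.sqrt_eq_rpow]
    rw [h4] at h1
    have h5 := h1.trans (mul_le_mul_left h3 _)
    rw [← ENNReal.ofReal_mul (by positivity), ← ofReal_norm] at h5
    exact (ENNReal.ofReal_le_ofReal_iff (by positivity)).1 h5
  have hall : ∀ v, ‖inner ℂ v h‖ ≤ C * ‖v‖ * √K := by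
    have hclosed : IsClosed {v : 𝓗 | ‖inner ℂ v h‖ ≤ C * ‖v‖ * √K} :=
      isClosed_le (by fun_prop) (by fun_prop)
    intro v
    exact hclosed.closure_subset_iff.2 (fun v hv => hinner v hv) (hH.dense_domain v)
  have h6 := hall h
  have h7 : ‖inner ℂ h h‖ = ‖h‖ * ‖h‖ := by
    rw [inner_self_eq_norm_sq_to_K, ← sq]
    simp
  rw [h7] at h6
  have h8 : ‖h‖ ≤ C * √K := by
    by_contra h9
    rw [not_le] at h9
    have h10 : 0 < ‖h‖ := lt_of_le_of_lt (by positivity) h9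
    nlinarith
  calc ‖h‖ ^ 2 ≤ (C * √K) ^ 2 := by gcongr
    _ = C ^ 2 * K := by rw [mul_pow, Real.sq_sqrt (abs_nonneg _)]

end Wave

/-! ### Asymptotic localization of the energy -/

section Localization

variable {H H₀ : 𝓗 →ₗ.[ℂ] 𝓗} {G : 𝓗 →ₗ.[ℂ] 𝓖} {G₀ : 𝓗 →ₗ.[ℂ] 𝓖}

/-- The resolvent identity `(H - z)⁻¹ - (H₀ - z)⁻¹ = -(G (H - z̄)⁻¹)* G₀ (H₀ - z)⁻¹`, as an estimate:
`u` and `v` are the images of the same vector under the two resolvents. -/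
theorem FormBound.exists_norm_sub_le (hV : FormBound H H₀ G G₀) (hH : IsSelfAdjoint H)
    (hG : IsRelBounded G H) (a : ℝ) : ∃ C : ℝ, 0 ≤ C ∧
      ∀ (u : H₀.domain) (v : H.domain) (n : ℝ), 0 ≤ n → pmapNorm G₀ u ≤ ENNReal.ofReal n →
        H v - (a + Complex.I) • (v : 𝓗) = H₀ u - (a + Complex.I) • (u : 𝓗) →
          ‖(u : 𝓗) - v‖ ≤ C * n := by
  obtain ⟨C, hC0, hC⟩ := hG.exists_pmapNorm_le
  refine ⟨C * (1 + |a|), by positivity, fun u v n hn hun huv => ?_⟩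
  set h := (u : 𝓗) - v with hh
  -- test `h` against itself, written as `h = (H - z̄) k`
  obtain ⟨k, hk⟩ := exists_apply_add_smul_eq hH (-a) one_ne_zero h
  set c : ℂ := ((-a : ℝ) : ℂ) + ((1 : ℝ) : ℂ) * Complex.I with hc
  have hkn : ‖(k : 𝓗)‖ ≤ ‖h‖ := by
    have h1 := norm_apply_add_smul_sq hH (-a) 1 k
    rw [hk] at h1
    refine abs_le_of_sq_le_sq' ?_ (norm_nonneg _) |>.2
    rw [h1]
    nlinarith [sq_nonneg ‖H k + ((-a : ℝ) : ℂ) • (k : 𝓗)‖]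
  have hkI : ‖H k + Complex.I • (k : 𝓗)‖ ≤ (1 + |a|) * ‖h‖ := by
    have h1 : H k + Complex.I • (k : 𝓗) = h + (a : ℂ) • (k : 𝓗) := by
      rw [← hk, hc, add_smul]
      push_cast
      rw [one_mul, neg_smul]
      abel
    rw [h1]
    calc _ ≤ ‖h‖ + ‖(a : ℂ) • (k : 𝓗)‖ := norm_add_le _ _
      _ = ‖h‖ + |a| * ‖(k : 𝓗)‖ := by rw [norm_smul, Complex.norm_real, Real.norm_eq_abs]
      _ ≤ ‖h‖ + |a| * ‖h‖ := by gcongr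
      _ = _ := by ring
  have hinner : inner ℂ h h = inner ℂ (H k) (u : 𝓗) - inner ℂ (k : 𝓗) (H₀ u) := by
    have hcc : (starRingEnd ℂ) c = -(a + Complex.I) := by
      rw [hc, map_add, map_mul, Complex.conj_ofReal, Complex.conj_ofReal, Complex.conj_I]
      push_cast
      ring
    have h1 : inner ℂ h (v : 𝓗) = inner ℂ (k : 𝓗) (H₀ u - (a + Complex.I) • (u : 𝓗)) := by
      rw [← huv, ← hk, inner_add_left, inner_smul_left, hcc, inner_apply_left hH, inner_sub_right,
        inner_smul_right]
      ring
    have h2 : inner ℂ h (u : 𝓗) = inner ℂ (H k) (u : 𝓗) - (a + Complex.I) * inner ℂ (k : 𝓗) (u : 𝓗)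
        := by
      rw [← hk, inner_add_left, inner_smul_left, hcc]
      ring
    conv_lhs => enter [3]; rw [hh]
    rw [inner_sub_right, h1, h2, inner_sub_right, inner_smul_right]
    ring
  have h1 : ‖inner ℂ h h‖ ≤ C * ((1 + |a|) * ‖h‖) * n := by
    have h2 : ‖inner ℂ h h‖ₑ ≤ ENNReal.ofReal (C * ((1 + |a|) * ‖h‖)) * ENNReal.ofReal n := by
      rw [hinner]
      refine (hV k u).trans (mul_le_mul' ((hC k).trans (ENNReal.ofReal_le_ofReal ?_)) hun)
      gcongr
    rw [← ENNReal.ofReal_mul (by positivity), ← ofReal_norm] at h2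
    exact (ENNReal.ofReal_le_ofReal_iff (by positivity)).1 h2
  have h7 : ‖inner ℂ h h‖ = ‖h‖ * ‖h‖ := by
    rw [inner_self_eq_norm_sq_to_K, ← sq]
    simp
  rw [h7] at h1
  by_contra h9
  rw [not_le] at h9
  have h10 : 0 < ‖h‖ := lt_of_le_of_lt (by positivity) h9
  nlinarith

theorem norm_apply_sub_add_I_sq (hH : IsSelfAdjoint H) (a : ℝ) (f : H.domain) :
    ‖H f - (a + Complex.I) • (f : 𝓗)‖ ^ 2 = ‖H f - (a : ℂ) • (f : 𝓗)‖ ^ 2 + ‖(f : 𝓗)‖ ^ 2 := by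
  have h := norm_apply_add_smul_sq hH (-a) (-1) f
  have h1 : H f + ((-a : ℝ) + (-1 : ℝ) * Complex.I : ℂ) • (f : 𝓗) =
      H f - (a + Complex.I) • (f : 𝓗) := by
    rw [sub_eq_add_neg, ← neg_smul]
    congr 2
    push_cast
    ring
  have h2 : H f + ((-a : ℝ) : ℂ) • (f : 𝓗) = H f - (a : ℂ) • (f : 𝓗) := by
    rw [sub_eq_add_neg, ← neg_smul]
    congr 2
    push_cast
    ring
  rw [h1, h2] at h
  rw [h]; ring

/-- Passing to `w = (H₀ - z) f` gains a factor `d⁻¹` away from the energy `a`, up to the error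
`G₀ e^{-iH₀t} f`. -/
theorem FormBound.exists_norm_toFun_le (hV : FormBound H H₀ G G₀) (hH : IsSelfAdjoint H)
    (hH₀ : IsSelfAdjoint H₀) (hG : IsRelBounded G H) {a δ : ℝ} (hδ : 0 < δ) {Z : Set ℝ}
    (hZ : MeasurableSet Z) (hZa : ∀ l ∈ Z, δ ≤ |l - a|) : ∃ C : ℝ, 0 ≤ C ∧
      ∀ (f : H₀.domain) (t n : ℝ), 0 ≤ n →
        pmapNorm G₀ (evolution H₀ t f) ≤ ENNReal.ofReal n →
        ‖(spectralMeasure H).toFun Z (evolution H₀ t f)‖ ≤ (√(δ ^ 2 + 1))⁻¹ *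
          ‖(spectralMeasure H).toFun Z (evolution H₀ t (H₀ f - (a + Complex.I) • (f : 𝓗)))‖ +
          C * n := by
  obtain ⟨C, hC0, hC⟩ := hV.exists_norm_sub_le hH hG a
  refine ⟨C, hC0, fun f t n hn hfn => ?_⟩
  have hU₀ := isUnitaryGroupOf_evolution hH₀
  set E := spectralMeasure H with hE
  obtain ⟨u, hu1, hu2⟩ := (LinearPMap.mem_graph_iff H₀).1 (hU₀.mem_graph (H₀.mem_graph f) t)
  simp only at hu1 hu2
  set w := evolution H₀ t (H₀ f - (a + Complex.I) • (f : 𝓗)) with hw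
  have huw : H₀ u - (a + Complex.I) • (u : 𝓗) = w := by
    rw [hw, map_sub, map_smul, hu1, hu2]
  obtain ⟨v, hv⟩ := exists_apply_add_smul_eq hH (-a) (b := -1) (by norm_num) w
  have hv' : H v - (a + Complex.I) • (v : 𝓗) = w := by
    rw [← hv, sub_eq_add_neg, ← neg_smul]
    congr 2
    push_cast
    ring
  have h1 : ‖(u : 𝓗) - v‖ ≤ C * n := hC u v n hn (by rwa [hu1]) (by rw [hv', huw])
  obtain ⟨v', hv1, hv2⟩ := (LinearPMap.mem_graph_iff H).1 (toFun_mem_graph hH hZ (H.mem_graph v))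
  simp only at hv1 hv2
  have hvw : H v' - (a + Complex.I) • (v' : 𝓗) = E.toFun Z w := by
    rw [← hv', map_sub, map_smul, hv1, hv2]
  have hfix : E.toFun Z v' = v' := by rw [hv1, toFun_toFun _ hZ]
  have h2 := norm_apply_sub_add_I_sq hH a v'
  have h3 := le_norm_apply_sub hH hZ hδ.le hZa v' hfix
  have hd : 0 < √(δ ^ 2 + 1) := by positivity
  have h4 : ‖(v' : 𝓗)‖ ≤ (√(δ ^ 2 + 1))⁻¹ * ‖E.toFun Z w‖ := by
    rw [le_inv_mul_iff₀ hd]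
    refine abs_le_of_sq_le_sq' ?_ (norm_nonneg _) |>.2
    rw [← hvw, h2, mul_pow, Real.sq_sqrt (by positivity)]
    have : (δ * ‖(v' : 𝓗)‖) ^ 2 ≤ ‖H v' - (a : ℂ) • (v' : 𝓗)‖ ^ 2 := by gcongr
    nlinarith
  rw [← hu1]
  calc ‖E.toFun Z u‖ = ‖(v' : 𝓗) + E.toFun Z ((u : 𝓗) - v)‖ := by
        rw [map_sub, hv1]; congr 1; abel
    _ ≤ ‖(v' : 𝓗)‖ + ‖E.toFun Z ((u : 𝓗) - v)‖ := norm_add_le _ _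
    _ ≤ _ := add_le_add h4 ((norm_toFun_le E hZ _).trans h1)

/-- A state of energy in `K`, close to `a`, has asymptotically no `H`-energy in a set `Z` away from
`a`: each of the `n` factors `H₀ - z` that are put in front of the state costs less than it gains. -/
theorem FormBound.tendsto_toFun_zero (hV : FormBound H H₀ G G₀) (hH : IsSelfAdjoint H)
    (hH₀ : IsSelfAdjoint H₀) (hG : IsRelBounded G H) (hG₀ : IsRelBounded G₀ H₀) {X K Z : Set ℝ}
    (hX : MeasurableSet X) (hK : MeasurableSet K) (hZ : MeasurableSet Z)
    (hsX : IsSmooth (compBounded G₀ ((spectralMeasure H₀).toFun X)) H₀) (hKX : K ⊆ X)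
    {a δ : ℝ} (hδ : 0 < δ) (hKa : ∀ l ∈ K, |l - a| ≤ δ) (hZa : ∀ l ∈ Z, 2 * δ ≤ |l - a|)
    {l : Filter ℝ} (hl : l = atTop ∨ l = atBot) {f : 𝓗}
    (hf : (spectralMeasure H₀).toFun K f = f) :
    Tendsto (fun t => (spectralMeasure H).toFun Z (evolution H₀ t f)) l (𝓝 0) := by
  have hU₀ := isUnitaryGroupOf_evolution hH₀
  obtain ⟨C, hC0, hC⟩ := hV.exists_norm_toFun_le hH hH₀ hG (δ := 2 * δ) (by positivity) hZ hZa
  obtain ⟨C₀, -, hC₀⟩ := hsX.exists_lintegral_le hX hH₀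
  have hKb : Bornology.IsBounded K := by
    refine (Metric.isBounded_closedBall (x := a) (r := δ)).subset fun l hl => ?_
    rw [Metric.mem_closedBall, Real.dist_eq]
    exact hKa l hl
  set b := √(δ ^ 2 + 1) with hb
  set d := √((2 * δ) ^ 2 + 1) with hd
  have hbpos : 0 < b := by positivity
  have hdpos : 0 < d := by positivity
  have hd1 : 1 ≤ d := by
    rw [hd, Real.one_le_sqrt]
    nlinarith [sq_nonneg (2 * δ)]
  have hq1 : d⁻¹ * b < 1 := by
    rw [inv_mul_lt_iff₀ hdpos, mul_one]
    refine Real.sqrt_lt_sqrt (by positivity) ?_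
    nlinarith [sq_pos_of_pos hδ]
  -- each step passes from `f` to `g = (H₀ - z) f`: `‖g‖ ≤ b ‖f‖`, and the resolvent gains `d⁻¹`
  have key : ∀ n : ℕ, ∀ f : 𝓗, (spectralMeasure H₀).toFun K f = f → ∀ ε > 0, ∀ᶠ t in l,
      ‖(spectralMeasure H).toFun Z (evolution H₀ t f)‖ ≤ (d⁻¹ * b) ^ n * ‖f‖ + ε := by
    intro n
    induction n with
    | zero =>
      intro f _ ε hε
      refine Eventually.of_forall fun t => ?_
      have h1 := norm_toFun_le (spectralMeasure H) hZ (evolution H₀ t f)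
      rw [hU₀.norm_map] at h1
      rw [pow_zero, one_mul]
      linarith
    | succ n ih =>
      intro f hf ε hε
      have hfd := mem_domain_of_toFun_eq hH₀ hK hKb hf
      obtain ⟨c, hcu, hcn⟩ := hG₀.exists_trajectory hH₀ hfd
      have hfin : ∫⁻ t, ‖c t‖ₑ ^ 2 ≠ ⊤ := by
        have h1 := hC₀ f hfd
        rw [toFun_eq_of_subset _ hK hX hKX hf] at h1
        simp only [hcn] at h1
        exact (lt_of_le_of_lt h1 (ENNReal.pow_lt_top ENNReal.ofReal_lt_top)).ne
      -- the error term `G₀ e^{-iH₀t} f` of the step is square integrable in time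
      have hc0 : Tendsto c l (𝓝 0) := by
        rcases hl with rfl | rfl
        · exact tendsto_zero_of_uniformContinuous hcu hfin atTop_le_cocompact
        · exact tendsto_zero_of_uniformContinuous hcu hfin atBot_le_cocompact
      set g := H₀ ⟨f, hfd⟩ - (a + Complex.I) • f with hg
      have hgK : (spectralMeasure H₀).toFun K g = g := by
        obtain ⟨f', hf1, hf2⟩ := (LinearPMap.mem_graph_iff H₀).1
          (toFun_mem_graph hH₀ hK (H₀.mem_graph ⟨f, hfd⟩))
        simp only [hf] at hf1 hf2
        have h1 : f' = ⟨f, hfd⟩ := Subtype.ext hf1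
        rw [hg, map_sub, map_smul, hf, ← hf2, h1]
      have hgn : ‖g‖ ≤ b * ‖f‖ := by
        have h1 := norm_apply_sub_add_I_sq hH₀ a ⟨f, hfd⟩
        have h2 := norm_apply_sub_le hH₀ hK hδ.le hKa ⟨f, hfd⟩ hf
        refine abs_le_of_sq_le_sq' ?_ (by positivity) |>.2
        rw [hg, h1, mul_pow, hb, Real.sq_sqrt (by positivity)]
        have : ‖H₀ ⟨f, hfd⟩ - (a : ℂ) • f‖ ^ 2 ≤ (δ * ‖f‖) ^ 2 := by gcongr
        simp only
        nlinarith
      have hcε : ∀ᶠ t in l, C * ‖c t‖ < ε / 2 := by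
        have h1 : Tendsto (fun t => C * ‖c t‖) l (𝓝 (C * ‖(0 : 𝓖)‖)) := hc0.norm.const_mul C
        rw [norm_zero, mul_zero] at h1
        exact h1.eventually (gt_mem_nhds (by positivity))
      filter_upwards [ih g hgK (ε / 2) (by positivity), hcε] with t ht1 ht2
      have h1 := hC ⟨f, hfd⟩ t ‖c t‖ (norm_nonneg _) (by rw [hcn, ofReal_norm])
      have h3 : d⁻¹ ≤ 1 := inv_le_one_of_one_le₀ hd1
      have h4 : 0 ≤ d⁻¹ * b := by positivity
      calc _ ≤ d⁻¹ * ‖(spectralMeasure H).toFun Z (evolution H₀ t g)‖ + C * ‖c t‖ := h1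
        _ ≤ d⁻¹ * ((d⁻¹ * b) ^ n * (b * ‖f‖) + ε / 2) + ε / 2 := by
            refine add_le_add (mul_le_mul_of_nonneg_left (ht1.trans ?_) (by positivity)) ht2.le
            gcongr
        _ = (d⁻¹ * b) ^ (n + 1) * ‖f‖ + d⁻¹ * (ε / 2) + ε / 2 := by ring
        _ ≤ (d⁻¹ * b) ^ (n + 1) * ‖f‖ + ε := by nlinarith
  rw [Metric.tendsto_nhds]
  intro ε hε
  have hpow : Tendsto (fun n : ℕ => (d⁻¹ * b) ^ n * ‖f‖) atTop (𝓝 0) := by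
    have := (tendsto_pow_atTop_nhds_zero_of_lt_one (by positivity) hq1).mul_const ‖f‖
    rwa [zero_mul] at this
  obtain ⟨n, hn⟩ := (hpow.eventually (gt_mem_nhds (show (0 : ℝ) < ε / 2 by positivity))).exists
  filter_upwards [key n f hf (ε / 4) (by positivity)] with t ht
  rw [dist_zero_right]
  linarith

end Localization

/-! ### Convergence on the absolutely continuous subspace and completeness -/

section Completeness

variable {H H₀ : 𝓗 →ₗ.[ℂ] 𝓗} {G : 𝓗 →ₗ.[ℂ] 𝓖} {G₀ : 𝓗 →ₗ.[ℂ] 𝓖}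

/-- Convergence of `e^{iHt} e^{-iH₀t} f` for a state `f` of energy in a small set `K`: the part in
`E(Y)` converges by Cook's method, and the part in `E(Yᶜ)` vanishes asymptotically. -/
theorem FormBound.exists_tendsto_of_toFun_eq (hV : FormBound H H₀ G G₀) (hH : IsSelfAdjoint H)
    (hH₀ : IsSelfAdjoint H₀) (hG : IsRelBounded G H) (hG₀ : IsRelBounded G₀ H₀) {X Y K : Set ℝ}
    (hX : MeasurableSet X) (hY : MeasurableSet Y) (hK : MeasurableSet K)
    (hsX : IsSmooth (compBounded G₀ ((spectralMeasure H₀).toFun X)) H₀)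
    (hsY : IsSmooth (compBounded G ((spectralMeasure H).toFun Y)) H)
    (hKX : K ⊆ X) {a δ : ℝ} (hδ : 0 < δ) (hKa : ∀ l ∈ K, |l - a| ≤ δ)
    (hYa : ∀ l, |l - a| ≤ 2 * δ → l ∈ Y) {l : Filter ℝ} (hl : l = atTop ∨ l = atBot) {f : 𝓗}
    (hf : (spectralMeasure H₀).toFun K f = f) :
    ∃ g, Tendsto (fun t => evolution H (-t) (evolution H₀ t f)) l (𝓝 g) := by
  have hU := isUnitaryGroupOf_evolution hH
  have hKb : Bornology.IsBounded K := by
    refine (Metric.isBounded_closedBall (x := a) (r := δ)).subset fun l hl => ?_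
    rw [Metric.mem_closedBall, Real.dist_eq]
    exact hKa l hl
  have hfd := mem_domain_of_toFun_eq hH₀ hK hKb hf
  obtain ⟨g, hg⟩ := hV.exists_tendsto_toFun hH hH₀ hG hG₀ hX hY hsX hsY hl hfd
    (toFun_eq_of_subset _ hK hX hKX hf)
  have h0 := hV.tendsto_toFun_zero hH hH₀ hG hG₀ hX hK hY.compl hsX hKX hδ hKa
    (fun l hl => by
      by_contra h
      exact hl (hYa l (not_le.1 h).le)) hl hf
  have h1 : Tendsto (fun t => (spectralMeasure H).toFun Yᶜ
      (evolution H (-t) (evolution H₀ t f))) l (𝓝 0) := by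
    rw [tendsto_zero_iff_norm_tendsto_zero] at h0 ⊢
    refine h0.congr fun t => ?_
    rw [toFun_evolution hH hY.compl, hU.norm_map]
  refine ⟨g + 0, (hg.add h1).congr fun t => ?_⟩
  rw [toFun_add_toFun_compl _ hY]

variable (H H₀) in
/-- The vectors `f` for which `e^{iHt} e^{-iH₀t} f` converges along `l`. -/
def convergenceSubspace (l : Filter ℝ) : Submodule ℂ 𝓗 where
  carrier := {f | ∃ g, Tendsto (fun t => evolution H (-t) (evolution H₀ t f)) l (𝓝 g)}
  zero_mem' := ⟨0, by simpa using tendsto_const_nhds⟩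
  add_mem' := by
    rintro f f' ⟨g, hg⟩ ⟨g', hg'⟩
    exact ⟨g + g', by simpa using hg.add hg'⟩
  smul_mem' := by
    rintro c f ⟨g, hg⟩
    exact ⟨c • g, by simpa using hg.const_smul c⟩

theorem isClosed_convergenceSubspace (hH : IsSelfAdjoint H) (hH₀ : IsSelfAdjoint H₀)
    (l : Filter ℝ) [l.NeBot] : IsClosed (convergenceSubspace H H₀ l : Set 𝓗) := by
  have hU := isUnitaryGroupOf_evolution hH
  have hU₀ := isUnitaryGroupOf_evolution hH₀
  refine isClosed_of_closure_subset fun f hf => ?_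
  change ∃ g, Tendsto (fun t => evolution H (-t) (evolution H₀ t f)) l (𝓝 g)
  rw [← cauchy_map_iff_exists_tendsto, Metric.cauchy_iff]
  refine ⟨inferInstance, fun ε hε => ?_⟩
  obtain ⟨f', ⟨g, hg⟩, hff'⟩ := Metric.mem_closure_iff.1 hf (ε / 4) (by positivity)
  refine ⟨_, image_mem_map (Metric.tendsto_nhds.1 hg (ε / 4) (by positivity)), ?_⟩
  have hiso : ∀ t, dist (evolution H (-t) (evolution H₀ t f))
      (evolution H (-t) (evolution H₀ t f')) < ε / 4 := by
    intro t
    rw [dist_eq_norm, ← map_sub, ← map_sub, hU.norm_map, hU₀.norm_map, ← dist_eq_norm]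
    exact hff'
  rintro _ ⟨s, hs, rfl⟩ _ ⟨t, ht, rfl⟩
  simp only [Set.mem_ofPred_eq] at hs ht
  set x := evolution H (-s) (evolution H₀ s f)
  set y := evolution H (-t) (evolution H₀ t f)
  set x' := evolution H (-s) (evolution H₀ s f')
  set y' := evolution H (-t) (evolution H₀ t f')
  have h1 : dist x x' < ε / 4 := hiso s
  have h2 : dist y y' < ε / 4 := hiso t
  have h3 := dist_triangle4 x x' y' y
  have h4 := dist_triangle_right x' y' g
  rw [dist_comm y' y] at h3
  linarith

/-- Two countable families of intervals which both cover almost all of the line have a common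
countable refinement of this kind by small intervals. -/
theorem exists_refinement {X Y : ℕ → Set ℝ} (hX : ∀ n, (X n).OrdConnected)
    (hY : ∀ n, (Y n).OrdConnected) (hX0 : volume (⋃ n, X n)ᶜ = 0)
    (hY0 : volume (⋃ n, Y n)ᶜ = 0) :
    ∃ K : ℕ → Set ℝ, (∀ i, MeasurableSet (K i)) ∧ volume (⋃ i, K i)ᶜ = 0 ∧
      ∀ i, (K i).Nonempty → ∃ (n m : ℕ) (a δ : ℝ), 0 < δ ∧ K i ⊆ X n ∧ (∀ l ∈ K i, |l - a| ≤ δ) ∧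
        ∀ l, |l - a| ≤ 2 * δ → l ∈ Y m := by
  classical
  -- the index `(n, m, a, δ)` stands for the closed ball around `a` of radius `δ`, provided that the
  -- ball of radius `2δ` lies in `X n ∩ Y m`
  let good : ℕ × ℕ × ℚ × ℚ → Prop := fun i =>
    0 < i.2.2.2 ∧ Metric.closedBall (i.2.2.1 : ℝ) (2 * i.2.2.2) ⊆ X i.1 ∩ Y i.2.1
  let B : ℕ × ℕ × ℚ × ℚ → Set ℝ := fun i =>
    if good i then Metric.closedBall (i.2.2.1 : ℝ) i.2.2.2 else ∅
  obtain ⟨e, he⟩ := exists_surjective_nat (ℕ × ℕ × ℚ × ℚ)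
  refine ⟨fun k => B (e k), fun k => ?_, ?_, fun k hk => ?_⟩
  · simp only [B]
    split_ifs
    exacts [measurableSet_closedBall, MeasurableSet.empty]
  · -- a point that is covered by both families but by no ball is an end point of an interval
    have hsub : (⋃ k, B (e k))ᶜ ⊆ ((⋃ n, X n)ᶜ ∪ (⋃ n, Y n)ᶜ) ∪
        ((⋃ n, frontier (X n)) ∪ ⋃ n, frontier (Y n)) := by
      intro x hx
      by_contra hcon
      simp only [Set.mem_union, not_or, Set.mem_compl_iff, not_not] at hcon
      obtain ⟨⟨hxX, hxY⟩, hfX, hfY⟩ := hcon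
      obtain ⟨n, hn⟩ := Set.mem_iUnion.1 hxX
      obtain ⟨m, hm⟩ := Set.mem_iUnion.1 hxY
      simp only [Set.mem_compl_iff, Set.mem_iUnion, not_exists] at hx hfX hfY
      have hnX : x ∈ interior (X n) := by
        by_contra h
        exact hfX n ⟨subset_closure hn, h⟩
      have hmY : x ∈ interior (Y m) := by
        by_contra h
        exact hfY m ⟨subset_closure hm, h⟩
      obtain ⟨η, hη, hball⟩ := Metric.mem_nhds_iff.1
        (inter_mem (mem_interior_iff_mem_nhds.1 hnX) (mem_interior_iff_mem_nhds.1 hmY))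
      obtain ⟨a, ha1, ha2⟩ := exists_rat_btwn (show x < x + η / 8 by linarith)
      obtain ⟨δ, hδ1, hδ2⟩ := exists_rat_btwn (show η / 8 < η / 4 by linarith)
      obtain ⟨k, hk⟩ := he (n, m, a, δ)
      refine hx k ?_
      have hδ0 : (0 : ℝ) < δ := by linarith
      have hgood : good (n, m, a, δ) := by
        refine ⟨by exact_mod_cast hδ0, fun y hy => hball ?_⟩
        rw [Metric.mem_closedBall, Real.dist_eq, abs_le] at hy
        rw [Metric.mem_ball, Real.dist_eq, abs_lt]
        simp only at hy
        constructor <;> linarith [hy.1, hy.2]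
      rw [hk]
      simp only [B, if_pos hgood]
      rw [Metric.mem_closedBall, Real.dist_eq, abs_le]
      constructor <;> linarith
    refine measure_mono_null hsub ?_
    refine measure_union_null (measure_union_null hX0 hY0) (measure_union_null ?_ ?_)
    · exact measure_iUnion_null fun n => (hX n).convex.addHaar_frontier volume
    · exact measure_iUnion_null fun n => (hY n).convex.addHaar_frontier volume
  · simp only [B] at hk ⊢
    by_cases hgood : good (e k)
    · simp only [if_pos hgood]
      have hδ : (0 : ℝ) < (e k).2.2.2 := by exact_mod_cast hgood.1
      refine ⟨(e k).1, (e k).2.1, (e k).2.2.1, (e k).2.2.2, hδ, ?_, fun l hl => ?_, fun l hl => ?_⟩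
      · refine (Metric.closedBall_subset_closedBall ?_).trans
          (hgood.2.trans Set.inter_subset_left)
        linarith
      · rwa [Metric.mem_closedBall, Real.dist_eq] at hl
      · refine (hgood.2 ?_).2
        rwa [Metric.mem_closedBall, Real.dist_eq]
    · simp [if_neg hgood] at hk

/-- For `f` in the absolutely continuous subspace only the energies covered by the small sets matter,
so `f` is a sum of vectors for which convergence is known. -/
theorem FormBound.acSubspace_le (hV : FormBound H H₀ G G₀) (hH : IsSelfAdjoint H)
    (hH₀ : IsSelfAdjoint H₀) (hG : IsLocallySmooth G H) (hG₀ : IsLocallySmooth G₀ H₀)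
    {l : Filter ℝ} (hl : l = atTop ∨ l = atBot) :
    acSubspace H₀ ≤ convergenceSubspace H H₀ l := by
  have hlne : l.NeBot := by rcases hl with rfl | rfl <;> infer_instance
  obtain ⟨hGb, Y, hY, hY0, hYs⟩ := hG
  obtain ⟨hG₀b, X, hX, hX0, hXs⟩ := hG₀
  obtain ⟨K, hKm, hK0, hK⟩ := exists_refinement hX hY hX0 hY0
  intro f hf
  have hdm : ∀ i, MeasurableSet (disjointed K i) := fun i => MeasurableSet.disjointed hKm i
  have hsum := (spectralMeasure H₀).hasSum (disjointed K) hdm (disjoint_disjointed K) f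
  have hKU : MeasurableSet (⋃ i, K i) := MeasurableSet.iUnion hKm
  have hfix : (spectralMeasure H₀).toFun (⋃ i, K i) f = f := by
    have h1 := toFun_add_toFun_compl (spectralMeasure H₀) hKU f
    rwa [((spectralMeasure H₀).absolutelyContinuous_iff f).1 hf _ hKU.compl hK0, add_zero] at h1
  rw [iUnion_disjointed, hfix] at hsum
  refine (isClosed_convergenceSubspace hH hH₀ l).mem_of_tendsto hsum
    (Eventually.of_forall fun s => Submodule.sum_mem _ fun i _ => ?_)
  by_cases hne : (K i).Nonempty
  · obtain ⟨n, m, a, δ, hδ, hKX, hKa, hYa⟩ := hK i hne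
    exact hV.exists_tendsto_of_toFun_eq hH hH₀ hGb hG₀b (hX n).measurableSet (hY m).measurableSet
      (hdm i) (hXs n) (hYs m) ((disjointed_subset K i).trans hKX) hδ
      (fun l hl => hKa l (disjointed_subset K i hl)) hYa hl (toFun_toFun _ (hdm i) f)
  · have h1 : disjointed K i = ∅ :=
      Set.subset_empty_iff.1 (Set.not_nonempty_iff_eq_empty.1 hne ▸ disjointed_subset K i)
    rw [h1, ProjectionMeasure.empty]
    exact zero_mem _

/-- A strong limit `g` of `e^{iHt} e^{-iH₀t} f` has the same spectral distribution with respect to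
`H` as `f` with respect to `H₀`: by intertwining, the Fourier transforms of the two agree. -/
theorem scalarMeasure_eq_of_tendsto (hH : IsSelfAdjoint H) (hH₀ : IsSelfAdjoint H₀) {l : Filter ℝ}
    (hl : l = atTop ∨ l = atBot) {f g : 𝓗}
    (h : Tendsto (fun t => evolution H (-t) (evolution H₀ t f)) l (𝓝 g)) :
    (spectralMeasure H).scalarMeasure g = (spectralMeasure H₀).scalarMeasure f := by
  have hlne : l.NeBot := by rcases hl with rfl | rfl <;> infer_instance
  have hU := isUnitaryGroupOf_evolution hH
  have hU₀ := isUnitaryGroupOf_evolution hH₀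
  refine Measure.ext_of_charFun (funext fun r => ?_)
  rw [charFun_scalarMeasure hH, charFun_scalarMeasure hH₀]
  set s := -r
  have hshift : Tendsto (fun t => t + s) l l := by
    rcases hl with rfl | rfl
    · exact tendsto_atTop_add_const_right _ _ tendsto_id
    · exact tendsto_atBot_add_const_right _ _ tendsto_id
  have h1 : Tendsto (fun t => evolution H (-t) (evolution H₀ t (evolution H₀ s f))) l
      (𝓝 (evolution H s g)) := by
    refine (((evolution H s).continuous.tendsto g).comp (h.comp hshift)).congr fun t => ?_
    simp only [Function.comp_apply]
    rw [← hU.add_apply, ← hU₀.add_apply]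
    congr 2
    ring
  refine tendsto_nhds_unique (h.inner h1) (tendsto_const_nhds.congr fun t => ?_)
  rw [hU.inner_map_map, hU₀.inner_map_map]

theorem FormBound.waveOperatorExistsComplete (hV : FormBound H H₀ G G₀) (hH : IsSelfAdjoint H)
    (hH₀ : IsSelfAdjoint H₀) (hG : IsLocallySmooth G H) (hG₀ : IsLocallySmooth G₀ H₀)
    {l : Filter ℝ} (hl : l = atTop ∨ l = atBot) : WaveOperatorExistsComplete H H₀ l := by
  have hlne : l.NeBot := by rcases hl with rfl | rfl <;> infer_instance
  have hU := isUnitaryGroupOf_evolution hH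
  have hU₀ := isUnitaryGroupOf_evolution hH₀
  have hconv : ∀ f, ∃ g, Tendsto (fun t => evolution H (-t) (evolution H₀ t
      ((acSubspace H₀).starProjection f))) l (𝓝 g) := fun f =>
    hV.acSubspace_le hH hH₀ hG hG₀ hl (Submodule.starProjection_apply_mem _ f)
  choose w hw using hconv
  let W : 𝓗 →L[ℂ] 𝓗 := LinearMap.mkContinuous
    { toFun := w
      map_add' := fun x y => tendsto_nhds_unique (hw (x + y)) (by simpa using (hw x).add (hw y))
      map_smul' := fun c x => tendsto_nhds_unique (hw (c • x)) (by simpa using (hw x).const_smul c) }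
    1 (fun f => by
      refine le_of_tendsto (hw f).norm (Eventually.of_forall fun t => ?_)
      rw [hU.norm_map, hU₀.norm_map, one_mul]
      exact Submodule.norm_starProjection_apply_le _ f)
  refine ⟨W, hw, Set.Subset.antisymm ?_ ?_⟩
  · rintro _ ⟨f, rfl⟩
    change (spectralMeasure H).scalarMeasure (w f) ≪ volume
    rw [scalarMeasure_eq_of_tendsto hH hH₀ hl (hw f)]
    exact Submodule.starProjection_apply_mem (acSubspace H₀) f
  · intro g hg
    obtain ⟨f, hf⟩ := hV.symm.acSubspace_le hH₀ hH hG₀ hG hl hg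
    have hfac : f ∈ acSubspace H₀ := by
      change (spectralMeasure H₀).scalarMeasure f ≪ volume
      rw [scalarMeasure_eq_of_tendsto hH₀ hH hl hf]
      exact hg
    refine ⟨f, tendsto_nhds_unique (hw f) ?_⟩
    rw [Submodule.starProjection_eq_self_iff.2 hfac]
    rw [tendsto_iff_norm_sub_tendsto_zero] at hf ⊢
    refine hf.congr fun t => ?_
    rw [← hU.norm_map t (evolution H (-t) (evolution H₀ t f) - g), map_sub, hU.apply_neg,
      ← hU₀.norm_map t (evolution H₀ (-t) (evolution H t g) - f), map_sub, hU₀.apply_neg,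
      norm_sub_rev]

end Completeness

end Scattering

end

theorem mainTheorem7
    {𝓗 : Type*} [NormedAddCommGroup 𝓗] [InnerProductSpace ℂ 𝓗] [CompleteSpace 𝓗]
    {𝓖 : Type*} [NormedAddCommGroup 𝓖] [InnerProductSpace ℂ 𝓖] [CompleteSpace 𝓖]
    (H H₀ : 𝓗 →ₗ.[ℂ] 𝓗) (hH : IsSelfAdjoint H) (hH₀ : IsSelfAdjoint H₀)
    (G G₀ : 𝓗 →ₗ.[ℂ] 𝓖)
    (hV : Scattering.DifferenceFactors H H₀ G G₀)
    (hG₀ : Scattering.IsLocallySmooth G₀ H₀)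
    (hG : Scattering.IsLocallySmooth G H) :
    Scattering.WaveOperatorExistsComplete H H₀ Filter.atTop ∧
      Scattering.WaveOperatorExistsComplete H H₀ Filter.atBot :=
  ⟨hV.formBound.waveOperatorExistsComplete hH hH₀ hG hG₀ (Or.inl rfl),
    hV.formBound.waveOperatorExistsComplete hH hH₀ hG hG₀ (Or.inr rfl)⟩
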